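/- Let $n\geq 2$ be an integer and $a=\exp\left(\frac{2\pi i}{2n}\right)$. Consider the complex $2n\times 2n$ matrices \[ D=\mathrm{diag}(1,a,a^2,\ldots,a^{2n-1}),\qquad S=\begin{pmatrix}0&1&&\\&\ddots&\ddots&\\&&\ddots&1\\1&&&0\end{pmatrix} \] as supermatrices on an $(n|n)$-dimensional superspace in the alternating format (even, odd, even, odd, ...), so that $D$ is even and $S$ is odd. Let $[\cdot,\cdot]$ be the supercommutator, $\mathrm{ad}\,x(y)=[x,y]$, and let $\mathfrak{sl}(n|n)$ be the Lie superalgebra of supermatrices of supertrace $0$. For $1\le k\le 2n$ put \[ T_m^k=(\mathrm{ad}\,D)^{k-1}(\mathrm{ad}\,S)^{m-1}([D,S])\quad(1\le m\le 2n-1),\qquad T_{2n}^k=[S,T_{2n-1}^k]. \] Then $D$ and $S$ generate the Lie superalgebra $\mathfrak{sl}(n|n)$, and \[ \mathfrak{sl}(n|n)=\mathrm{Span}\left(D,\,S,\,T_m^k \;\middle|\; 1\le k,m\le 2n,\ k\ne 2n \text{ for } m=1,\ k\neq 1\text{ for } m=2n\right). \] Among these elements $T_{2n}^n=0$, and the remaining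 ones form a basis of $\mathfrak{sl}(n|n)$. A defining set of relations is given by (1)-(6) below; that is, they hold in $\mathfrak{sl}(n|n)$, and the kernel of the surjective homomorphism onto $\mathfrak{sl}(n|n)$ from the free Lie superalgebra on an even generator $D$ and an odd generator $S$ is the ideal generated by them (where $T_m^k$ is given by the same iterated superbrackets of the free generators): \begin{align*} (1)\quad& (\mathrm{ad}\,D)^{2n}(S)=(1-a)^{2n}S,\\ (2)\quad& (\mathrm{ad}\,D)^{2n}(\mathrm{ad}\,S)^{m-1}([D,S])=(1-a^m)^{2n}(\mathrm{ad}\,S)^{m-1}([D,S])\qquad(2\le m\le 2n-1),\\ (3)\quad& [S,T_{2n-1}^1]=(-1)^{n+1}(1-a^2)^n D,\\ (4)\quad& [S,T_{2n}^k]=(a^2-1)^{n-1}(a^{2k}-1)\left(\frac{1-a^{2n-1}}{1-a}\right)^{k-1}T_1^k\qquad(2\le k\le 2n),\\ (5)\quad& [S,S]=\frac{2}{(1-a^2)^{2n}}\,T_2^{2n}, \end{align*} and, for each $T_m^k$ with $2\le m\le 2n-1$, $1\le k\le 2n$, the $m-1$ relations \[ (6)\quad (\mathrm{ad}\,S)^{s_1}(T_{s_2+1}^k)=\left(\frac{1-a^{s_2+1}}{1-a^{m}}\right)^{k-1}c\;T_m^k,\qquad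 s_1+s_2=m-1,\quad s_1=1,\ldots,m-1, \] with \[ c=\begin{cases} \left(\frac{a^{2k}-1}{a^2-1}\right)^{\frac{s_1-1}{2}}\frac{a^k+1}{a+1} & s_1 \text{ odd},\ s_2\text{ even},\\[1ex] \left(\frac{a^{2k}-1}{a^2-1}\right)^{\frac{s_1-1}{2}}\frac{a^k-1}{a-1} & s_1,s_2 \text{ odd},\\[1ex] \left(\frac{a^{2k}-1}{a^2-1}\right)^{\frac{s_1}{2}} & s_1\text{ even}. \end{cases} \] -/

import Mathlib

noncomputable section

/-! ### Lie superalgebras over the complex numbers -/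

/-- The Koszul sign `(-1)^(i j)` of two parities. -/
def koszul (i j : ZMod 2) : ℂ := if i = 1 ∧ j = 1 then -1 else 1

/-- A complex Lie superalgebra: a space `L = L₀ ⊕ L₁` with an even bilinear superbracket which is
super-antisymmetric and satisfies the super Jacobi identity. -/
class LieSuperalgebra (L : Type*) [AddCommGroup L] [Module ℂ L] where
  /-- the even (`0`) and the odd (`1`) part -/
  part : ZMod 2 → Submodule ℂ L
  isCompl_part : IsCompl (part 0) (part 1)
  /-- the superbracket -/
  bracket : L →ₗ[ℂ] L →ₗ[ℂ] L
  bracket_mem : ∀ i j x y, x ∈ part i → y ∈ part j → bracket x y ∈ part (i + j)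
  bracket_skew : ∀ i j x y, x ∈ part i → y ∈ part j →
    bracket x y = -(koszul i j • bracket y x)
  jacobi : ∀ i j l x y z, x ∈ part i → y ∈ part j → z ∈ part l →
    bracket x (bracket y z) = bracket (bracket x y) z + koszul i j • bracket y (bracket x z)

namespace LieSuperalgebra

section

variable {L : Type*} [AddCommGroup L] [Module ℂ L] [LieSuperalgebra L]

/-- The adjoint operator `y ↦ [x, y]`. -/
def ad (x : L) : Module.End ℂ L := bracket x

/-- `W = (W ∩ L₀) ⊕ (W ∩ L₁)`. -/
def IsGraded (W : Submodule ℂ L) : Prop := W = (W ⊓ part 0) ⊔ (W ⊓ part 1)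

/-- Sub-superalgebras. -/
def IsSubalgebra (W : Submodule ℂ L) : Prop :=
  IsGraded W ∧ ∀ x ∈ W, ∀ y ∈ W, ad x y ∈ W

/-- Ideals (two-sided, by super-antisymmetry). -/
def IsIdeal (I : Submodule ℂ L) : Prop :=
  IsGraded I ∧ ∀ x, ∀ y ∈ I, ad x y ∈ I

/-- The sub-superalgebra generated by a set. -/
def generated (R : Set L) : Submodule ℂ L :=
  sInf {W | R ⊆ W ∧ IsSubalgebra W}

/-- The ideal generated by a set. -/
def idealGenerated (R : Set L) : Submodule ℂ L :=
  sInf {I | R ⊆ I ∧ IsIdeal I}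

end

end LieSuperalgebra

/-! ### The free Lie superalgebra -/

namespace FreeLieSuper

variable {X : Type*}

/-- The parity of a nonassociative word in letters of given parities. -/
def wordParity (p : X → ZMod 2) : FreeMagma X → ZMod 2
  | .of x => p x
  | .mul u v => wordParity p u + wordParity p v

/-- The free nonassociative algebra: formal linear combinations of nonassociative words. -/
abbrev Pre (X : Type*) := FreeMagma X →₀ ℂ

/-- The product of the free nonassociative algebra, extending the product of words. -/
def mulPre : Pre X →ₗ[ℂ] Pre X →ₗ[ℂ] Pre X :=
  Finsupp.linearCombination ℂ (fun u => Finsupp.lmapDomain ℂ ℂ (fun v => u * v))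

/-- A word, as an element of the free nonassociative algebra. -/
def word (u : FreeMagma X) : Pre X := Finsupp.single u 1

lemma mulPre_word (u v : FreeMagma X) : mulPre (word u) (word v) = word (u * v) := by
  simp [mulPre, word]

/-- Super-antisymmetry and super Jacobi identity on words. -/
inductive Identity (p : X → ZMod 2) : Pre X → Prop
  | skew (u v : FreeMagma X) : Identity p
      (word (u * v) + koszul (wordParity p u) (wordParity p v) • word (v * u))
  | jacobi (u v w : FreeMagma X) : Identity p
      (word (u * (v * w)) - word ((u * v) * w)
        - koszul (wordParity p u) (wordParity p v) • word (v * (u * w)))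

/-- The two-sided ideal of the free nonassociative algebra generated by the identities. -/
def identityIdeal (p : X → ZMod 2) : Submodule ℂ (Pre X) :=
  sInf {I | (∀ r, Identity p r → r ∈ I) ∧ ∀ x, ∀ y ∈ I, mulPre x y ∈ I ∧ mulPre y x ∈ I}

lemma identity_mem (p : X → ZMod 2) {r : Pre X} (h : Identity p r) : r ∈ identityIdeal p := by
  simp only [identityIdeal, Submodule.mem_sInf]
  exact fun I hI => hI.1 r h

lemma mul_mem (p : X → ZMod 2) (x : Pre X) {y : Pre X} (h : y ∈ identityIdeal p) :
    mulPre x y ∈ identityIdeal p ∧ mulPre y x ∈ identityIdeal p := by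
  simp only [identityIdeal, Submodule.mem_sInf] at h ⊢
  exact ⟨fun I hI => (hI.2 x y (h I hI)).1, fun I hI => (hI.2 x y (h I hI)).2⟩

/-- The part of given parity of an element of the free nonassociative algebra. -/
def comp (p : X → ZMod 2) (i : ZMod 2) : Pre X →ₗ[ℂ] Pre X :=
  Finsupp.linearCombination ℂ (fun u => if wordParity p u = i then word u else 0)

lemma comp_word (p : X → ZMod 2) (i : ZMod 2) (u : FreeMagma X) :
    comp p i (word u) = if wordParity p u = i then word u else 0 := by
  simp [comp, word]

lemma pre_induction {P : Pre X → Prop} (h0 : P 0) (hadd : ∀ x y, P x → P y → P (x + y))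
    (hsmul : ∀ (c : ℂ) x, P x → P (c • x)) (hw : ∀ u, P (word u)) (x : Pre X) : P x := by
  induction x using Finsupp.induction_linear with
  | zero => exact h0
  | add f g hf hg => exact hadd _ _ hf hg
  | single u c => simpa [word] using hsmul c _ (hw u)

lemma wordParity_mul (p : X → ZMod 2) (u v : FreeMagma X) :
    wordParity p (u * v) = wordParity p u + wordParity p v := rfl

lemma comp_mul_left (p : X → ZMod 2) (i : ZMod 2) (u : FreeMagma X) (y : Pre X) :
    comp p i (mulPre (word u) y) = mulPre (word u) (comp p (i - wordParity p u) y) := by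
  induction y using pre_induction with
  | h0 => simp
  | hadd x y hx hy => simp [hx, hy]
  | hsmul c x hx => simp [hx]
  | hw v =>
    rw [mulPre_word, comp_word, comp_word]
    have : wordParity p (u * v) = i ↔ wordParity p v = i - wordParity p u := by
      rw [wordParity_mul, eq_sub_iff_add_eq']
    by_cases h : wordParity p v = i - wordParity p u
    · simp [this, h, mulPre_word]
    · simp [this, h]

lemma comp_mul_right (p : X → ZMod 2) (i : ZMod 2) (u : FreeMagma X) (y : Pre X) :
    comp p i (mulPre y (word u)) = mulPre (comp p (i - wordParity p u) y) (word u) := by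
  induction y using pre_induction with
  | h0 => simp
  | hadd x y hx hy => simp [hx, hy]
  | hsmul c x hx => simp [hx]
  | hw v =>
    rw [mulPre_word, comp_word, comp_word]
    have : wordParity p (v * u) = i ↔ wordParity p v = i - wordParity p u := by
      rw [wordParity_mul, eq_sub_iff_add_eq]
    by_cases h : wordParity p v = i - wordParity p u
    · simp [this, h, mulPre_word]
    · simp [this, h]

lemma comp_mem (p : X → ZMod 2) {x : Pre X} (hx : x ∈ identityIdeal p) (i : ZMod 2) :
    comp p i x ∈ identityIdeal p := by
  let K : Submodule ℂ (Pre X) := ⨅ i, (identityIdeal p).comap (comp p i)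
  have hK : ∀ z, z ∈ K ↔ ∀ i, comp p i z ∈ identityIdeal p := by
    intro z; simp [K, Submodule.mem_iInf]
  have hle : identityIdeal p ≤ K := by
    refine sInf_le ⟨?_, ?_⟩
    · intro r hr
      rw [hK]
      intro i
      cases hr with
      | skew u v =>
        have := identity_mem p (Identity.skew (p := p) u v)
        have h : wordParity p (v * u) = wordParity p (u * v) := by
          rw [wordParity_mul, wordParity_mul, add_comm]
        simp only [map_add, map_smul, comp_word, h]
        split_ifs
        · exact this
        · simp
      | jacobi u v w =>
        have := identity_mem p (Identity.jacobi (p := p) u v w)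
        have h : wordParity p ((u * v) * w) = wordParity p (u * (v * w)) := by
          simp only [wordParity_mul, add_assoc]
        have h' : wordParity p (v * (u * w)) = wordParity p (u * (v * w)) := by
          simp only [wordParity_mul, add_left_comm]
        simp only [map_sub, map_smul, comp_word, h, h']
        split_ifs
        · exact this
        · simp
    · intro x y hy
      rw [hK] at hy
      constructor
      · rw [hK]
        intro i
        induction x using pre_induction with
        | h0 => simp
        | hadd x y hx hy => simpa using add_mem hx hy
        | hsmul c x hx => simpa using Submodule.smul_mem _ c hx
        | hw u => rw [comp_mul_left]; exact (mul_mem p _ (hy _)).1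
      · rw [hK]
        intro i
        induction x using pre_induction with
        | h0 => simp
        | hadd x y hx hy => simpa using add_mem hx hy
        | hsmul c x hx => simpa using Submodule.smul_mem _ c hx
        | hw u => rw [comp_mul_right]; exact (mul_mem p _ (hy _)).2
  exact (hK x).1 (hle hx) i

end FreeLieSuper

open FreeLieSuper in
/-- The free Lie superalgebra on letters of parities `p`: the free nonassociative algebra modulo
super-antisymmetry and the super Jacobi identity. -/
abbrev FreeLieSuperalgebra {X : Type*} (p : X → ZMod 2) := Pre X ⧸ identityIdeal p

namespace FreeLieSuper

variable {X : Type*} (p : X → ZMod 2)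

/-- The class of a word in the free Lie superalgebra. -/
def mk (u : FreeMagma X) : FreeLieSuperalgebra p := (identityIdeal p).mkQ (word u)

/-- The superbracket, induced by the product of words. -/
def bracketF : FreeLieSuperalgebra p →ₗ[ℂ] FreeLieSuperalgebra p →ₗ[ℂ] FreeLieSuperalgebra p :=
  (identityIdeal p).liftQ
    (LinearMap.flip ((identityIdeal p).liftQ
      (LinearMap.flip (mulPre.compr₂ (identityIdeal p).mkQ)) (by
        intro y hy
        rw [LinearMap.mem_ker]
        refine LinearMap.ext fun x => ?_
        exact (Submodule.Quotient.mk_eq_zero _).2 (mul_mem p x hy).1)))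
    (by
      intro x hx
      rw [LinearMap.mem_ker]
      refine LinearMap.ext fun y => ?_
      obtain ⟨y, rfl⟩ := (identityIdeal p).mkQ_surjective y
      exact (Submodule.Quotient.mk_eq_zero _).2 (mul_mem p y hx).2)

lemma bracketF_mk (u v : FreeMagma X) : bracketF p (mk p u) (mk p v) = mk p (u * v) := by
  simp only [bracketF, mk, Submodule.mkQ_apply, Submodule.liftQ_apply, LinearMap.flip_apply,
    LinearMap.compr₂_apply, mulPre_word]

/-- The part of parity `i`, spanned by the words of parity `i`. -/
def partF (i : ZMod 2) : Submodule ℂ (FreeLieSuperalgebra p) :=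
  Submodule.span ℂ {x | ∃ u, wordParity p u = i ∧ x = mk p u}

/-- The projection to the part of parity `i`. -/
def projF (i : ZMod 2) : FreeLieSuperalgebra p →ₗ[ℂ] FreeLieSuperalgebra p :=
  (identityIdeal p).mapQ (identityIdeal p) (comp p i) (fun _ hx => comp_mem p hx i)

lemma projF_mk (i : ZMod 2) (u : FreeMagma X) :
    projF p i (mk p u) = if wordParity p u = i then mk p u else 0 := by
  simp only [projF, mk, Submodule.mkQ_apply, Submodule.mapQ_apply, comp_word]
  split_ifs <;> simp

lemma projF_of_mem {i j : ZMod 2} {x : FreeLieSuperalgebra p} (hx : x ∈ partF p i) :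
    projF p j x = if i = j then x else 0 := by
  induction hx using Submodule.span_induction with
  | mem x h =>
    obtain ⟨u, rfl, rfl⟩ := h
    exact projF_mk p j u
  | zero => simp
  | add x y _ _ hx hy => rw [map_add, hx, hy]; split_ifs <;> simp
  | smul c x _ hx => rw [map_smul, hx]; split_ifs <;> simp

/-- The free Lie superalgebra is a Lie superalgebra. -/
instance instFree : LieSuperalgebra (FreeLieSuperalgebra p) where
  part := partF p
  isCompl_part := by
    constructor
    · rw [Submodule.disjoint_def]
      intro x h0 h1
      have a := projF_of_mem p (j := 0) h0
      have b := projF_of_mem p (j := 0) h1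
      rw [if_pos rfl] at a
      rw [if_neg (by decide)] at b
      rw [← a, b]
    · rw [codisjoint_iff, eq_top_iff]
      rintro x -
      obtain ⟨x, rfl⟩ := (identityIdeal p).mkQ_surjective x
      induction x using pre_induction with
      | h0 => simp
      | hadd x y hx hy => rw [map_add]; exact add_mem hx hy
      | hsmul c x hx => rw [map_smul]; exact Submodule.smul_mem _ c hx
      | hw u =>
        have h : wordParity p u = 0 ∨ wordParity p u = 1 := by
          generalize wordParity p u = t
          revert t; decide
        rcases h with h | h
        · exact Submodule.mem_sup_left (Submodule.subset_span ⟨u, h, rfl⟩)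
        · exact Submodule.mem_sup_right (Submodule.subset_span ⟨u, h, rfl⟩)
  bracket := bracketF p
  bracket_mem := by
    intro i j x y hx hy
    induction hx, hy using Submodule.span_induction₂ with
    | mem_mem x y hx hy =>
      obtain ⟨u, rfl, rfl⟩ := hx
      obtain ⟨v, rfl, rfl⟩ := hy
      rw [bracketF_mk]
      exact Submodule.subset_span ⟨u * v, rfl, rfl⟩
    | zero_left => simp
    | zero_right => simp
    | add_left x y z _ _ _ hx hy => simpa using add_mem hx hy
    | add_right x y z _ _ _ hx hy => simpa using add_mem hx hy
    | smul_left c x y _ _ h => simpa using Submodule.smul_mem _ c h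
    | smul_right c x y _ _ h => simpa using Submodule.smul_mem _ c h
  bracket_skew := by
    intro i j x y hx hy
    induction hx, hy using Submodule.span_induction₂ with
    | mem_mem x y hx hy =>
      obtain ⟨u, rfl, rfl⟩ := hx
      obtain ⟨v, rfl, rfl⟩ := hy
      rw [bracketF_mk, bracketF_mk, eq_neg_iff_add_eq_zero]
      simp only [mk, ← map_smul, ← map_add]
      rw [Submodule.mkQ_apply, Submodule.Quotient.mk_eq_zero]
      exact identity_mem p (.skew u v)
    | zero_left => simp
    | zero_right => simp
    | add_left x y z _ _ _ hx hy => simp only [map_add, LinearMap.add_apply, hx, hy]; module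
    | add_right x y z _ _ _ hx hy => simp only [map_add, LinearMap.add_apply, hx, hy]; module
    | smul_left c x y _ _ h => simp only [map_smul, LinearMap.smul_apply, h]; module
    | smul_right c x y _ _ h => simp only [map_smul, LinearMap.smul_apply, h]; module
  jacobi := by
    intro i j l x y z hx hy hz
    induction hz using Submodule.span_induction with
    | mem z hz =>
      obtain ⟨w, -, rfl⟩ := hz
      induction hx, hy using Submodule.span_induction₂ with
      | mem_mem x y hx hy =>
        obtain ⟨u, rfl, rfl⟩ := hx
        obtain ⟨v, rfl, rfl⟩ := hy
        simp only [bracketF_mk]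
        rw [← sub_eq_zero, ← sub_sub]
        simp only [mk, ← map_smul, ← map_sub]
        rw [Submodule.mkQ_apply, Submodule.Quotient.mk_eq_zero]
        exact identity_mem p (.jacobi u v w)
      | zero_left => simp
      | zero_right => simp
      | add_left x y z _ _ _ hx hy => simp only [map_add, LinearMap.add_apply, hx, hy]; module
      | add_right x y z _ _ _ hx hy => simp only [map_add, LinearMap.add_apply, hx, hy]; module
      | smul_left c x y _ _ h => simp only [map_smul, LinearMap.smul_apply, h]; module
      | smul_right c x y _ _ h => simp only [map_smul, LinearMap.smul_apply, h]; module
    | zero => simp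
    | add x y _ _ hx hy => simp only [map_add, hx, hy]; module
    | smul c x _ hx => simp only [map_smul, hx]; module

/-- The generators of the free Lie superalgebra. -/
def gen (x : X) : FreeLieSuperalgebra p := mk p (.of x)

section lift

variable {L : Type*} [AddCommGroup L] [Module ℂ L] [LieSuperalgebra L]

/-- The value of a word in a Lie superalgebra. -/
def evalWord (f : X → L) : FreeMagma X → L
  | .of x => f x
  | .mul u v => LieSuperalgebra.bracket (evalWord f u) (evalWord f v)

lemma evalWord_mem (f : X → L) (hf : ∀ x, f x ∈ LieSuperalgebra.part (p x)) (u : FreeMagma X) :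
    evalWord f u ∈ (LieSuperalgebra.part (wordParity p u) : Submodule ℂ L) := by
  induction u with
  | ih1 x => exact hf x
  | ih2 u v hu hv => exact LieSuperalgebra.bracket_mem _ _ _ _ hu hv

/-- The linear extension of `evalWord`. -/
def evalPre (f : X → L) : Pre X →ₗ[ℂ] L := Finsupp.linearCombination ℂ (evalWord f)

lemma evalPre_word (f : X → L) (u : FreeMagma X) : evalPre f (word u) = evalWord f u := by
  simp [evalPre, word]

lemma evalWord_mul (f : X → L) (u v : FreeMagma X) :
    evalWord f (u * v) = LieSuperalgebra.bracket (evalWord f u) (evalWord f v) := rfl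

lemma evalPre_mul (f : X → L) (x y : Pre X) :
    evalPre f (mulPre x y) = LieSuperalgebra.bracket (evalPre f x) (evalPre f y) := by
  induction x using pre_induction with
  | h0 => simp
  | hadd x y hx hy => simp [hx, hy]
  | hsmul c x hx => simp [hx]
  | hw u =>
    induction y using pre_induction with
    | h0 => simp
    | hadd x y hx hy => simp [hx, hy]
    | hsmul c x hx => simp [hx]
    | hw v => rw [mulPre_word, evalPre_word, evalPre_word, evalPre_word, evalWord_mul]

lemma identityIdeal_le_ker (f : X → L) (hf : ∀ x, f x ∈ LieSuperalgebra.part (p x)) :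
    identityIdeal p ≤ LinearMap.ker (evalPre f) := by
  refine sInf_le ⟨?_, ?_⟩
  · intro r hr
    rw [LinearMap.mem_ker]
    cases hr with
    | skew u v =>
      simp only [map_add, map_smul, evalPre_word, evalWord_mul]
      rw [LieSuperalgebra.bracket_skew _ _ _ _ (evalWord_mem p f hf u) (evalWord_mem p f hf v)]
      simp
    | jacobi u v w =>
      simp only [map_sub, map_smul, evalPre_word, evalWord_mul]
      rw [LieSuperalgebra.jacobi _ _ _ _ _ _ (evalWord_mem p f hf u) (evalWord_mem p f hf v)
        (evalWord_mem p f hf w)]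
      simp
  · intro x y hy
    rw [LinearMap.mem_ker] at hy
    simp [LinearMap.mem_ker, evalPre_mul, hy]

/-- The homomorphism from the free Lie superalgebra with given values on the generators. -/
def lift (f : X → L) (hf : ∀ x, f x ∈ LieSuperalgebra.part (p x)) :
    FreeLieSuperalgebra p →ₗ[ℂ] L :=
  (identityIdeal p).liftQ (evalPre f) (identityIdeal_le_ker p f hf)

lemma lift_gen (f : X → L) (hf : ∀ x, f x ∈ LieSuperalgebra.part (p x)) (x : X) :
    lift p f hf (gen p x) = f x := by
  simp only [lift, gen, mk, Submodule.mkQ_apply, Submodule.liftQ_apply, evalPre_word]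
  rfl

lemma lift_bracket (f : X → L) (hf : ∀ x, f x ∈ LieSuperalgebra.part (p x))
    (x y : FreeLieSuperalgebra p) :
    lift p f hf (LieSuperalgebra.bracket x y) =
      LieSuperalgebra.bracket (lift p f hf x) (lift p f hf y) := by
  obtain ⟨x, rfl⟩ := (identityIdeal p).mkQ_surjective x
  obtain ⟨y, rfl⟩ := (identityIdeal p).mkQ_surjective y
  exact evalPre_mul f x y

end lift

end FreeLieSuper

/-! ### Supermatrices in the alternating format -/

namespace SuperMatrix

variable (n : ℕ)

/-- `2n × 2n` complex matrices, on which the superspace structure of `gl(n|n)` in the alternating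
format (even, odd, even, odd, ...) is put below. -/
abbrev SMat := Matrix (Fin (2 * n)) (Fin (2 * n)) ℂ

variable {n}

/-- The parity of a row or column. -/
def par (r : Fin (2 * n)) : ZMod 2 := (r : ℕ)

/-- The component of parity `i` of a matrix. -/
def comp (i : ZMod 2) : SMat n →ₗ[ℂ] SMat n where
  toFun M := Matrix.of fun r c => if par r + par c = i then M r c else 0
  map_add' M N := by ext r c; simp only [Matrix.of_apply, Matrix.add_apply]; split_ifs <;> simp
  map_smul' k M := by
    ext r c; simp only [Matrix.of_apply, Matrix.smul_apply, RingHom.id_apply]; split_ifs <;> simp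

/-- The matrices of parity `i`. -/
def partM (i : ZMod 2) : Submodule ℂ (SMat n) where
  carrier := {M | ∀ r c, par r + par c ≠ i → M r c = 0}
  add_mem' := by intro M N hM hN r c h; simp [hM r c h, hN r c h]
  zero_mem' := by intro r c _; rfl
  smul_mem' := by intro k M hM r c h; simp [hM r c h]

lemma comp_of_mem {i : ZMod 2} {M : SMat n} (h : M ∈ partM i) (j : ZMod 2) :
    comp j M = if i = j then M else 0 := by
  ext r c
  simp only [comp, LinearMap.coe_mk, AddHom.coe_mk, Matrix.of_apply]
  by_cases hi : par r + par c = i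
  · by_cases hij : i = j
    · simp [hi, hij]
    · simp [hi, hij]
  · rw [h r c hi]
    split_ifs <;> simp [h r c hi]

/-- The supercommutator: the bilinear extension of `[M, N] = M N - (-1)^(i j) N M` for
`M`, `N` of parities `i`, `j`. -/
def bracketM : SMat n →ₗ[ℂ] SMat n →ₗ[ℂ] SMat n :=
  LinearMap.mk₂ ℂ
    (fun M N => M * N - ∑ i : ZMod 2, ∑ j : ZMod 2, koszul i j • (comp j N * comp i M))
    (by intro M M' N; simp only [map_add, add_mul, mul_add, smul_add, Finset.sum_add_distrib]; abel)
    (by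
      intro k M N
      simp only [map_smul, smul_mul_assoc, mul_smul_comm, smul_sub, Finset.smul_sum]
      simp only [smul_comm k])
    (by intro M N N'; simp only [map_add, add_mul, mul_add, smul_add, Finset.sum_add_distrib]; abel)
    (by
      intro k M N
      simp only [map_smul, smul_mul_assoc, mul_smul_comm, smul_sub, Finset.smul_sum]
      simp only [smul_comm k])

lemma bracketM_of_mem {i j : ZMod 2} {M N : SMat n} (hM : M ∈ partM i) (hN : N ∈ partM j) :
    bracketM M N = M * N - koszul i j • (N * M) := by
  simp only [bracketM, LinearMap.mk₂_apply, comp_of_mem hM, comp_of_mem hN]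
  rw [Finset.sum_eq_single i, Finset.sum_eq_single j]
  · simp
  · intro b _ hb
    simp [hb.symm]
  · simp
  · intro b _ hb
    simp [hb.symm]
  · simp

lemma mul_mem_part {i j : ZMod 2} {M N : SMat n} (hM : M ∈ partM i) (hN : N ∈ partM j) :
    M * N ∈ partM (i + j) := by
  intro r c h
  rw [Matrix.mul_apply]
  refine Finset.sum_eq_zero fun k _ => ?_
  by_cases h1 : par r + par k = i
  · by_cases h2 : par k + par c = j
    · exfalso
      apply h
      rw [← h1, ← h2]
      generalize par r = a
      generalize par k = b
      generalize par c = d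
      revert a b d
      decide
    · rw [hN k c h2, mul_zero]
  · rw [hM r k h1, zero_mul]

lemma bracketM_mem {i j : ZMod 2} {M N : SMat n} (hM : M ∈ partM i) (hN : N ∈ partM j) :
    bracketM M N ∈ partM (i + j) := by
  rw [bracketM_of_mem hM hN]
  refine sub_mem (mul_mem_part hM hN) (Submodule.smul_mem _ _ ?_)
  rw [add_comm]
  exact mul_mem_part hN hM

lemma koszul_comm (i j : ZMod 2) : koszul i j = koszul j i := by
  simp only [koszul, and_comm]

lemma zmod_two (i : ZMod 2) : i = 0 ∨ i = 1 := by
  revert i; decide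

lemma koszul_add (i j l : ZMod 2) : koszul i (j + l) = koszul i j * koszul i l := by
  rcases zmod_two i with rfl | rfl <;> rcases zmod_two j with rfl | rfl <;>
    rcases zmod_two l with rfl | rfl <;> simp [koszul, show (1 : ZMod 2) + 1 = 0 from rfl]

lemma koszul_eq (i j : ZMod 2) : koszul i j = 1 ∨ koszul i j = -1 := by
  unfold koszul; split_ifs <;> simp

/-- The Lie superalgebra `gl(n|n)` in the alternating format. -/
instance instMatrix : LieSuperalgebra (SMat n) where
  part := partM
  isCompl_part := by
    constructor
    · rw [Submodule.disjoint_def]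
      intro M h0 h1
      have a := comp_of_mem h0 0
      have b := comp_of_mem h1 0
      rw [if_pos rfl] at a
      rw [if_neg (by decide)] at b
      rw [← a, b]
    · rw [codisjoint_iff, eq_top_iff]
      rintro M -
      have h : M = comp 0 M + comp 1 M := by
        ext r c
        simp only [comp, LinearMap.coe_mk, AddHom.coe_mk, Matrix.add_apply, Matrix.of_apply]
        rcases zmod_two (par r + par c) with h | h <;> simp [h]
      have hm : ∀ i, comp i M ∈ partM i := by
        intro i r c hrc
        simp [comp, hrc]
      rw [h]
      exact Submodule.add_mem_sup (hm 0) (hm 1)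
  bracket := bracketM
  bracket_mem _ _ _ _ hM hN := bracketM_mem hM hN
  bracket_skew := by
    intro i j M N hM hN
    rw [bracketM_of_mem hM hN, bracketM_of_mem hN hM, koszul_comm j i]
    rcases koszul_eq i j with h | h <;> rw [h] <;> simp [add_comm]
  jacobi := by
    intro i j l M N K hM hN hK
    rw [bracketM_of_mem hM (bracketM_mem hN hK), bracketM_of_mem hN hK,
      bracketM_of_mem (bracketM_mem hM hN) hK, bracketM_of_mem hM hN,
      bracketM_of_mem hN (bracketM_mem hM hK), bracketM_of_mem hM hK,
      koszul_add, koszul_add, koszul_comm (i + j), koszul_add, koszul_comm l i, koszul_comm l j,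
      koszul_comm j i]
    rcases koszul_eq i j with h1 | h1 <;> rcases koszul_eq i l with h2 | h2 <;>
      rcases koszul_eq j l with h3 | h3 <;> rw [h1, h2, h3] <;>
      simp only [mul_one, mul_neg, neg_neg, one_smul, neg_smul] <;> noncomm_ring

variable (n)

/-- The supertrace: diagonal entries in odd positions count with a minus sign. -/
def supertrace : SMat n →ₗ[ℂ] ℂ :=
  ∑ r : Fin (2 * n), (-1 : ℂ) ^ (r : ℕ) • Matrix.entryLinearMap ℂ ℂ r r

/-- `sl(n|n)`: the supermatrices of supertrace zero. -/
def sl : Submodule ℂ (SMat n) := LinearMap.ker (supertrace n)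

/-- `a = exp(2πi/(2n))`. -/
def root : ℂ := Complex.exp (2 * Real.pi * Complex.I / ((2 * n : ℕ) : ℂ))

/-- The clock matrix `D = diag(1, a, ..., a^(2n-1))`. -/
def clock : SMat n := Matrix.diagonal fun r => root n ^ (r : ℕ)

/-- The shift matrix `S`: ones above the diagonal and in the lower left corner. -/
def shift : SMat n :=
  Matrix.of fun r c => if (c : ℕ) = ((r : ℕ) + 1) % (2 * n) then 1 else 0

lemma clock_mem : clock n ∈ (LieSuperalgebra.part 0 : Submodule ℂ (SMat n)) := by
  intro r c h
  refine Matrix.diagonal_apply_ne _ ?_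
  rintro rfl
  exact h (CharTwo.add_self_eq_zero _)

lemma shift_mem : shift n ∈ (LieSuperalgebra.part 1 : Submodule ℂ (SMat n)) := by
  intro r c h
  simp only [shift, Matrix.of_apply, ite_eq_right_iff, one_ne_zero, imp_false]
  intro hc
  apply h
  have h2 : ((((r : ℕ) + 1) % (2 * n) : ℕ) : ZMod 2) = (((r : ℕ) + 1 : ℕ) : ZMod 2) := by
    rw [ZMod.natCast_eq_natCast_iff]
    exact (Nat.mod_modEq _ _).of_dvd (Dvd.intro _ rfl)
  simp only [par, hc, h2]
  push_cast
  rw [← add_assoc, CharTwo.add_self_eq_zero, zero_add]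

end SuperMatrix

/-! ### Sylvester's generators: iterated superbrackets and relations -/

namespace Sylvester

open LieSuperalgebra SuperMatrix

section

variable {L : Type*} [AddCommGroup L] [Module ℂ L] [LieSuperalgebra L]

/-- The iterated superbrackets `T_m^k` of two elements `d`, `s` (for `1 ≤ k, m ≤ 2n`):
`(ad d)^(k-1) (ad s)^(m-1) [d, s]` for `m < 2n`, and `[s, T_(2n-1)^k]` for `m = 2n`. -/
def T (n : ℕ) (d s : L) (m k : ℕ) : L :=
  if m = 2 * n then ad s ((ad d ^ (k - 1)) ((ad s ^ (2 * n - 2)) (ad d s)))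
  else (ad d ^ (k - 1)) ((ad s ^ (m - 1)) (ad d s))

/-- The coefficient of `T_m^k`, `m = s₁ + s₂ + 1`, in `(ad s)^(s₁) (T_(s₂+1)^k)`. -/
def coeff (n k s₁ s₂ : ℕ) : ℂ :=
  let a := root n
  ((1 - a ^ (s₂ + 1)) / (1 - a ^ (s₁ + s₂ + 1))) ^ (k - 1) *
    if Even s₁ then ((a ^ (2 * k) - 1) / (a ^ 2 - 1)) ^ (s₁ / 2)
    else if Even s₂ then
      ((a ^ (2 * k) - 1) / (a ^ 2 - 1)) ^ ((s₁ - 1) / 2) * ((a ^ k + 1) / (a + 1))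
    else ((a ^ (2 * k) - 1) / (a ^ 2 - 1)) ^ ((s₁ - 1) / 2) * ((a ^ k - 1) / (a - 1))

/-- The defining relations `lhs = rhs` between `d` and `s`. -/
inductive Relation (n : ℕ) (d s : L) : L → L → Prop
  | rel1 : Relation n d s ((ad d ^ (2 * n)) s) ((1 - root n) ^ (2 * n) • s)
  | rel2 (m : ℕ) (h2 : 2 ≤ m) (hm : m ≤ 2 * n - 1) : Relation n d s
      ((ad d ^ (2 * n)) ((ad s ^ (m - 1)) (ad d s)))
      ((1 - root n ^ m) ^ (2 * n) • (ad s ^ (m - 1)) (ad d s))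
  | rel3 : Relation n d s
      (ad s (T n d s (2 * n - 1) 1))
      (((-1) ^ (n + 1) * (1 - root n ^ 2) ^ n) • d)
  | rel4 (k : ℕ) (h2 : 2 ≤ k) (hk : k ≤ 2 * n) : Relation n d s
      (ad s (T n d s (2 * n) k))
      (((root n ^ 2 - 1) ^ (n - 1) * (root n ^ (2 * k) - 1) *
        ((1 - root n ^ (2 * n - 1)) / (1 - root n)) ^ (k - 1)) • T n d s 1 k)
  | rel5 : Relation n d s
      (ad s s)
      ((2 / (1 - root n ^ 2) ^ (2 * n)) • T n d s 2 (2 * n))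
  | path (m k s₁ s₂ : ℕ) (h2 : 2 ≤ m) (hm : m ≤ 2 * n - 1) (hk1 : 1 ≤ k) (hk : k ≤ 2 * n)
      (hs₁ : 1 ≤ s₁) (hs : s₁ + s₂ = m - 1) : Relation n d s
      ((ad s ^ s₁) (T n d s (s₂ + 1) k))
      (coeff n k s₁ s₂ • T n d s m k)

end

/-- The pairs `(m, k)` for which `T_m^k` is listed in the spanning set. -/
def indexSet (n : ℕ) : Set (ℕ × ℕ) :=
  {q | 1 ≤ q.1 ∧ q.1 ≤ 2 * n ∧ 1 ≤ q.2 ∧ q.2 ≤ 2 * n ∧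
    (q.1 = 1 → q.2 ≠ 2 * n) ∧ (q.1 = 2 * n → q.2 ≠ 1)}

/-- The two letters. -/
inductive Letter
  | D
  | S

/-- `D` is even and `S` is odd. -/
def letterParity : Letter → ZMod 2
  | .D => 0
  | .S => 1

/-- The free Lie superalgebra on an even generator and an odd generator. -/
abbrev Free := FreeLieSuperalgebra letterParity

/-- The even generator. -/
def freeD : Free := FreeLieSuper.gen letterParity .D

/-- The odd generator. -/
def freeS : Free := FreeLieSuper.gen letterParity .S

/-- The letters as supermatrices. -/
def letterMatrix (n : ℕ) : Letter → SMat n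
  | .D => clock n
  | .S => shift n

lemma letterMatrix_mem (n : ℕ) (x : Letter) :
    letterMatrix n x ∈ (part (letterParity x) : Submodule ℂ (SMat n)) := by
  cases x
  · exact clock_mem n
  · exact shift_mem n

/-- The homomorphism from the free Lie superalgebra to `gl(n|n)` with `D ↦ D`, `S ↦ S`. -/
def toMatrix (n : ℕ) : Free →ₗ[ℂ] SMat n :=
  FreeLieSuper.lift letterParity (letterMatrix n) (letterMatrix_mem n)

end Sylvester

end

/-! Everything is read off from the matrices D^k S^m (`clockShift n m k`), a basis of all 2n × 2n
matrices as k and m run modulo 2n. Since S D = a D S, the brackets are [D, D^k S^m] = (1 - a^m)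
D^(k+1) S^m and [S, D^k S^m] = (a^k - (-1)^m) D^k S^(m+1). Hence T_m^k is an explicit multiple of
D^k S^m. Among the listed elements the multiple vanishes only for T_(2n)^n, because of its factor
a^n + 1. Up to nonzero scalars D, S and the remaining T_m^k are all the D^k S^m except D^n, the only
one with nonzero supertrace (`exists_clockShift_eq`, `span_generatorFamily`). The relations turn
into identities between scalars (`relation_clock_shift`).

For the presentation, divide the free Lie superalgebra by the relations. It is enough that d, s and
the remaining T_m^k span the quotient, because their images in matrices are linearly independent
(`ker_toMatrix`). A subspace containing d and s and stable under ad d and ad s is everything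
(`eq_top_of_ad_stable`). Most of this stability is immediate from the relations, but two facts are
not: [d, T_(2n)^k] = 0, and T_(2n)^n = 0.

Both are proved for a `ClockShiftSystem`. A discrete Fourier transform in k turns the normalized
T_m^k with 1 ≤ m < 2n into elements `matUnit n Y m i`, written E_(i,i+m) in the comments below,
which are eigenvectors of ad d. As s is the sum of the E_(i,i+1), comparing eigencomponents of [s,
E_(j,j+m)] gives every [E_(i,i+1), E_(j,j+m)] with m + 1 < 2n (`ad_unit_one`). For m = 2n - 1 the
Jacobi identity leaves two terms: [E_(j-1,j), E_(j,j-1)], of weight zero, and [E_(j+1,j+2),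
E_(j,j-1)], which `rel3` forces to vanish (`ad_unit_succ_last`). This yields the first fact. For the
second, expanding [E_(0,m), E_(m,0)] along m and closing the cycle by super-antisymmetry shows that
the alternating sum of the [E_(t,t+1), E_(t+1,t)] is zero, and T_(2n)^n is a multiple of that sum.
-/

noncomputable section

/-! ### Lie superalgebras in general: Jacobi identity, graded ideals, quotients. -/

namespace LieSuperalgebra

section general

variable {L : Type*} [AddCommGroup L] [Module ℂ L] [LieSuperalgebra L]

lemma koszul_natCast (m p : ℕ) : koszul (m : ZMod 2) (p : ZMod 2) = (-1) ^ (m * p) := by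
  have key (k : ℕ) : (k : ZMod 2) = 1 ↔ Odd k := ZMod.natCast_eq_one_iff_odd
  unfold koszul
  split_ifs with h
  · rw [key, key] at h
    exact ((h.1.mul h.2).neg_one_pow).symm
  · rw [key, key, ← Nat.odd_mul, Nat.not_odd_iff_even] at h
    exact h.neg_one_pow.symm

lemma ad_mem {i j : ZMod 2} {x y : L} (hx : x ∈ part i) (hy : y ∈ part j) :
    ad x y ∈ (part (i + j) : Submodule ℂ L) := bracket_mem _ _ _ _ hx hy

lemma ad_smul_left (c : ℂ) (x y : L) : ad (c • x) y = c • ad x y := by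
  simp only [ad, map_smul, LinearMap.smul_apply]

lemma ad_neg_left (x y : L) : ad (-x) y = -ad x y := by
  simp only [ad, map_neg, LinearMap.neg_apply]

lemma exists_decomp (x : L) :
    ∃ x₀ ∈ (part 0 : Submodule ℂ L), ∃ x₁ ∈ (part 1 : Submodule ℂ L), x₀ + x₁ = x := by
  have h : x ∈ (part 0 ⊔ part 1 : Submodule ℂ L) := by
    rw [isCompl_part.sup_eq_top]; trivial
  exact Submodule.mem_sup.1 h

lemma eq_zero_of_add_eq_zero {x₀ x₁ : L} (h₀ : x₀ ∈ (part 0 : Submodule ℂ L))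
    (h₁ : x₁ ∈ (part 1 : Submodule ℂ L)) (h : x₀ + x₁ = 0) : x₀ = 0 ∧ x₁ = 0 := by
  have h2 : x₀ = -x₁ := eq_neg_of_add_eq_zero_left h
  have h3 : x₀ = 0 :=
    Submodule.disjoint_def.1 isCompl_part.disjoint x₀ h₀ (h2 ▸ neg_mem h₁)
  refine ⟨h3, ?_⟩
  rw [h3, zero_add] at h
  exact h

/-- The parity of z does not enter the sign, so by linearity the Jacobi identity holds for
inhomogeneous z. -/
lemma ad_ad {i j : ZMod 2} {x y : L} (hx : x ∈ part i) (hy : y ∈ part j) (z : L) :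
    ad x (ad y z) = ad (ad x y) z + koszul i j • ad y (ad x z) := by
  obtain ⟨z₀, h₀, z₁, h₁, rfl⟩ := exists_decomp z
  have e₀ := jacobi _ _ _ _ _ _ hx hy h₀
  have e₁ := jacobi _ _ _ _ _ _ hx hy h₁
  simp only [ad, map_add] at *
  rw [e₀, e₁]
  module

lemma ad_skew {m p : ℕ} {x y : L} (hx : x ∈ part (m : ZMod 2)) (hy : y ∈ part (p : ZMod 2)) :
    ad x y = -((-1 : ℂ) ^ (m * p) • ad y x) := by
  rw [← koszul_natCast]
  exact bracket_skew _ _ _ _ hx hy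

lemma ad_ad_left {m p : ℕ} {x y : L} (hx : x ∈ part (m : ZMod 2)) (hy : y ∈ part (p : ZMod 2))
    (z : L) : ad (ad x y) z = ad x (ad y z) - (-1 : ℂ) ^ (m * p) • ad y (ad x z) := by
  rw [ad_ad hx hy, koszul_natCast, add_sub_cancel_right]

lemma ad_ad_even {d x : L} {i : ZMod 2} (hd : d ∈ part 0) (hx : x ∈ part i) (z : L) :
    ad d (ad x z) = ad (ad d x) z + ad x (ad d z) := by
  rw [ad_ad hd hx]
  simp [koszul]

lemma ad_self_even {d : L} (hd : d ∈ (part 0 : Submodule ℂ L)) : ad d d = 0 := by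
  have h := ad_skew (m := 0) (p := 0) (x := d) (y := d) (by simpa using hd) (by simpa using hd)
  rw [zero_mul, pow_zero, one_smul] at h
  have h2 : (2 : ℂ) • ad d d = 0 := by rw [two_smul]; nth_rewrite 1 [h]; exact neg_add_cancel _
  exact (smul_eq_zero.1 h2).resolve_left two_ne_zero

/-- This form of gradedness visibly passes to intersections, hence to `idealGenerated`. -/
lemma isGraded_iff {W : Submodule ℂ L} : IsGraded W ↔
    ∀ x₀ ∈ (part 0 : Submodule ℂ L), ∀ x₁ ∈ (part 1 : Submodule ℂ L), x₀ + x₁ ∈ W →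
      x₀ ∈ W ∧ x₁ ∈ W := by
  constructor
  · intro h x₀ h₀ x₁ h₁ hx
    rw [h] at hx
    obtain ⟨y₀, hy₀, y₁, hy₁, e⟩ := Submodule.mem_sup.1 hx
    have := eq_zero_of_add_eq_zero (sub_mem h₀ hy₀.2) (sub_mem h₁ hy₁.2)
      (by rw [sub_add_sub_comm, e, sub_self])
    rw [sub_eq_zero, sub_eq_zero] at this
    exact ⟨this.1 ▸ hy₀.1, this.2 ▸ hy₁.1⟩
  · intro h
    refine le_antisymm (fun x hx => ?_) (sup_le inf_le_left inf_le_left)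
    obtain ⟨x₀, h₀, x₁, h₁, rfl⟩ := exists_decomp x
    obtain ⟨a, b⟩ := h x₀ h₀ x₁ h₁ hx
    exact Submodule.add_mem_sup ⟨a, h₀⟩ ⟨b, h₁⟩

lemma isIdeal_idealGenerated (R : Set L) : IsIdeal (idealGenerated R) := by
  constructor
  · rw [isGraded_iff]
    intro x₀ h₀ x₁ h₁ hx
    simp only [idealGenerated, Submodule.mem_sInf] at hx ⊢
    have key := fun (I : Submodule ℂ L) (hI : R ⊆ I ∧ IsIdeal I) =>
      isGraded_iff.1 hI.2.1 x₀ h₀ x₁ h₁ (hx I hI)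
    exact ⟨fun I hI => (key I hI).1, fun I hI => (key I hI).2⟩
  · intro x y hy
    simp only [idealGenerated, Submodule.mem_sInf] at hy ⊢
    exact fun I hI => hI.2.2 x y (hy I hI)

lemma subset_idealGenerated (R : Set L) : R ⊆ idealGenerated R := by
  intro x hx
  simp only [idealGenerated, SetLike.mem_coe, Submodule.mem_sInf]
  exact fun I hI => hI.1 hx

/-- Antisymmetry is available only for homogeneous elements; gradedness keeps the components of x
inside the ideal. -/
lemma IsIdeal.ad_mem_left {I : Submodule ℂ L} (hI : IsIdeal I) {x : L} (hx : x ∈ I) (y : L) :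
    ad x y ∈ I := by
  obtain ⟨x₀, h₀, x₁, h₁, rfl⟩ := exists_decomp x
  obtain ⟨y₀, k₀, y₁, k₁, rfl⟩ := exists_decomp y
  obtain ⟨m₀, m₁⟩ := isGraded_iff.1 hI.1 x₀ h₀ x₁ h₁ hx
  have key : ∀ {i j : ZMod 2} {u v : L}, u ∈ part i → v ∈ part j → u ∈ I → ad u v ∈ I := by
    intro i j u v hu hv hm
    rw [ad, bracket_skew _ _ _ _ hu hv]
    exact neg_mem (Submodule.smul_mem _ _ (hI.2 v u hm))
  have h := add_mem (add_mem (key h₀ k₀ m₀) (key h₀ k₁ m₀)) (add_mem (key h₁ k₀ m₁) (key h₁ k₁ m₁))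
  convert h using 1
  simp only [ad, map_add, LinearMap.add_apply]
  abel

/-- The superbracket of the quotient by an ideal. -/
def quotientBracket (I : Submodule ℂ L) (hI : IsIdeal I) : (L ⧸ I) →ₗ[ℂ] (L ⧸ I) →ₗ[ℂ] (L ⧸ I) :=
  I.liftQ (LinearMap.flip (I.liftQ (LinearMap.flip (bracket.compr₂ I.mkQ)) (by
      intro y hy
      rw [LinearMap.mem_ker]
      refine LinearMap.ext fun x => ?_
      exact (Submodule.Quotient.mk_eq_zero _).2 (hI.2 x y hy)))) (by
    intro x hx
    rw [LinearMap.mem_ker]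
    refine LinearMap.ext fun y => ?_
    obtain ⟨y, rfl⟩ := I.mkQ_surjective y
    exact (Submodule.Quotient.mk_eq_zero _).2 (hI.ad_mem_left hx y))

lemma quotientBracket_mkQ (I : Submodule ℂ L) (hI : IsIdeal I) (x y : L) :
    quotientBracket I hI (I.mkQ x) (I.mkQ y) = I.mkQ (bracket x y) := rfl

/-- The quotient of a Lie superalgebra by an ideal. -/
@[reducible]
def quotient (I : Submodule ℂ L) (hI : IsIdeal I) : LieSuperalgebra (L ⧸ I) where
  part i := (part i).map I.mkQ
  isCompl_part := by
    constructor
    · rw [Submodule.disjoint_def]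
      rintro _ ⟨x₀, h₀, rfl⟩ ⟨x₁, h₁, e⟩
      have h : x₀ + -x₁ ∈ I := by
        rw [← sub_eq_add_neg, ← Submodule.Quotient.eq]; exact e.symm
      exact (Submodule.Quotient.mk_eq_zero _).2
        (isGraded_iff.1 hI.1 x₀ h₀ (-x₁) (neg_mem h₁) h).1
    · rw [codisjoint_iff, ← Submodule.map_sup, isCompl_part.sup_eq_top, Submodule.map_top,
        Submodule.range_mkQ]
  bracket := quotientBracket I hI
  bracket_mem := by
    rintro i j _ _ ⟨x, hx, rfl⟩ ⟨y, hy, rfl⟩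
    exact ⟨_, bracket_mem i j x y hx hy, (quotientBracket_mkQ I hI x y).symm⟩
  bracket_skew := by
    rintro i j _ _ ⟨x, hx, rfl⟩ ⟨y, hy, rfl⟩
    rw [quotientBracket_mkQ, quotientBracket_mkQ, bracket_skew i j x y hx hy, map_neg, map_smul]
  jacobi := by
    rintro i j l _ _ _ ⟨x, hx, rfl⟩ ⟨y, hy, rfl⟩ ⟨z, hz, rfl⟩
    simp only [quotientBracket_mkQ]
    rw [jacobi i j l x y z hx hy hz, map_add, map_smul]

/-- Elements whose `ad` preserves a subspace are closed under the superbracket. -/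
lemma ad_ad_stable {W : Submodule ℂ L} {i j : ZMod 2} {x y : L} (hx : x ∈ part i) (hy : y ∈ part j)
    (sx : ∀ w ∈ W, ad x w ∈ W) (sy : ∀ w ∈ W, ad y w ∈ W) : ∀ w ∈ W, ad (ad x y) w ∈ W := by
  intro w hw
  rw [← add_sub_cancel_right (ad (ad x y) w) (koszul i j • ad y (ad x w)), ← ad_ad hx hy]
  exact sub_mem (sx _ (sy _ hw)) (Submodule.smul_mem _ _ (sy _ (sx _ hw)))

end general

end LieSuperalgebra

/-! ### Transport of the relations along homomorphisms. -/

namespace Sylvester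

open LieSuperalgebra

section functoriality

variable {L L' : Type*} [AddCommGroup L] [Module ℂ L] [LieSuperalgebra L]
  [AddCommGroup L'] [Module ℂ L'] [LieSuperalgebra L']

lemma map_ad_pow {f : L →ₗ[ℂ] L'} (hf : ∀ x y, f (ad x y) = ad (f x) (f y)) (x y : L) (k : ℕ) :
    f ((ad x ^ k) y) = (ad (f x) ^ k) (f y) := by
  induction k with
  | zero => simp
  | succ k ih => rw [pow_succ', Module.End.mul_apply, hf, ih, pow_succ', Module.End.mul_apply]

lemma map_T {f : L →ₗ[ℂ] L'} (hf : ∀ x y, f (ad x y) = ad (f x) (f y)) (n : ℕ) (d s : L)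
    (m k : ℕ) : f (T n d s m k) = T n (f d) (f s) m k := by
  unfold T
  split_ifs <;> simp only [hf, map_ad_pow hf]

lemma Relation.map {f : L →ₗ[ℂ] L'} (hf : ∀ x y, f (ad x y) = ad (f x) (f y)) {n : ℕ} {d s : L}
    {x y : L} (h : Relation n d s x y) : Relation n (f d) (f s) (f x) (f y) := by
  cases h <;> simp only [map_smul, map_T hf, map_ad_pow hf, hf]
  · exact .rel1
  · exact .rel2 _ ‹_› ‹_›
  · exact .rel3
  · exact .rel4 _ ‹_› ‹_›
  · exact .rel5
  · exact .path _ _ _ _ ‹_› ‹_› ‹_› ‹_› ‹_› ‹_›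

/-- Applied to the quotient map: a relation between the classes of the generators is the image of
one in the free Lie superalgebra, hence holds in the quotient. -/
lemma Relation.exists_lift {f : L →ₗ[ℂ] L'} (hf : ∀ x y, f (ad x y) = ad (f x) (f y)) {n : ℕ}
    {d s : L} {x' y' : L'} (h : Relation n (f d) (f s) x' y') :
    ∃ x y, Relation n d s x y ∧ f x = x' ∧ f y = y' := by
  cases h
  · exact ⟨_, _, .rel1, by simp only [map_ad_pow hf], by simp only [map_smul]⟩
  · exact ⟨_, _, .rel2 _ ‹_› ‹_›, by simp only [map_ad_pow hf, hf],
      by simp only [map_smul, map_ad_pow hf, hf]⟩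
  · exact ⟨_, _, .rel3, by simp only [map_T hf, hf], by simp only [map_smul]⟩
  · exact ⟨_, _, .rel4 _ ‹_› ‹_›, by simp only [map_T hf, hf], by simp only [map_smul, map_T hf]⟩
  · exact ⟨_, _, .rel5, by simp only [hf], by simp only [map_smul, map_T hf]⟩
  · rename_i m k s₁ s₂ _ _ _ _ _ _
    exact ⟨_, _, .path m k s₁ s₂ ‹_› ‹_› ‹_› ‹_› ‹_› ‹_›, by simp only [map_ad_pow hf, map_T hf],
      by simp only [map_smul, map_T hf]⟩

end functoriality

end Sylvester

/-! ### Powers of the root of unity and the coefficients of the relations. -/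

namespace Sylvester

open LieSuperalgebra SuperMatrix

section roots

variable {n : ℕ}

lemma isPrimitiveRoot_root (hn : 2 ≤ n) : IsPrimitiveRoot (root n) (2 * n) :=
  Complex.isPrimitiveRoot_exp (2 * n) (by omega)

lemma root_pow_two_mul (hn : 2 ≤ n) : root n ^ (2 * n) = 1 := (isPrimitiveRoot_root hn).pow_eq_one

lemma one_sub_root_pow_ne_zero (hn : 2 ≤ n) {m : ℕ} (h1 : 1 ≤ m) (h2 : m < 2 * n) :
    1 - root n ^ m ≠ 0 := by
  rw [sub_ne_zero]
  exact ((isPrimitiveRoot_root hn).pow_ne_one_of_pos_of_lt (by omega) h2).symm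

lemma one_sub_root_ne_zero (hn : 2 ≤ n) : 1 - root n ≠ 0 := by
  simpa using one_sub_root_pow_ne_zero hn (m := 1) le_rfl (by omega)

lemma root_pow_half (hn : 2 ≤ n) : root n ^ n = -1 := by
  have h : (root n ^ n) ^ 2 = 1 := by rw [← pow_mul, mul_comm, root_pow_two_mul hn]
  have h2 : (root n ^ n - 1) * (root n ^ n + 1) = 0 := by linear_combination h
  refine eq_neg_of_add_eq_zero_left ((mul_eq_zero.1 h2).resolve_left (sub_ne_zero.2 ?_))
  exact (isPrimitiveRoot_root hn).pow_ne_one_of_pos_of_lt (by omega) (by omega)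

/-- Otherwise a^2 = 1, while a has order 2n ≥ 4. -/
lemma root_sub_sign_ne_zero (hn : 2 ≤ n) (j : ℕ) : root n - (-1) ^ j ≠ 0 := by
  intro h
  have h2 := one_sub_root_pow_ne_zero hn (m := 2) (by omega) (by omega)
  rw [sub_eq_zero.1 h, ← pow_mul, mul_comm, pow_mul] at h2
  simp at h2

lemma root_mul_root_pow_sub_one (hn : 2 ≤ n) : root n * root n ^ (2 * n - 1) = 1 := by
  rw [← pow_succ', Nat.sub_add_cancel (by omega), root_pow_two_mul hn]

lemma two_mul_cast_ne_zero (hn : 2 ≤ n) : (2 * n : ℂ) ≠ 0 := by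
  exact_mod_cast (by omega : 2 * n ≠ 0)

lemma zmod_natCast_ne_zero {k : ℕ} (h1 : 0 < k) (h2 : k < 2 * n) : (k : ZMod (2 * n)) ≠ 0 := by
  rw [Ne, ZMod.natCast_eq_zero_iff]
  exact fun h => absurd (Nat.le_of_dvd h1 h) (by omega)

lemma zmod_natCast_sub_two (hn : 2 ≤ n) : ((2 * n - 2 : ℕ) : ZMod (2 * n)) = -2 := by
  rw [Nat.cast_sub (by omega), ZMod.natCast_self]
  simp

variable (n) in
/-- The coefficient of `D S^m` in `(ad S)^(m-1) [D, S]`. -/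
def leading (m : ℕ) : ℂ :=
  (1 - root n) * ∏ j ∈ Finset.range (m - 1), (root n - (-1) ^ (j + 1))

lemma leading_ne_zero (hn : 2 ≤ n) (m : ℕ) : leading n m ≠ 0 :=
  mul_ne_zero (one_sub_root_ne_zero hn)
    (Finset.prod_ne_zero_iff.2 fun j _ => root_sub_sign_ne_zero hn (j + 1))

@[simp] lemma leading_one : leading n 1 = 1 - root n := by simp [leading]

lemma leading_succ {m : ℕ} (hm : 1 ≤ m) :
    leading n (m + 1) = leading n m * (root n - (-1) ^ m) := by
  obtain ⟨m, rfl⟩ := Nat.exists_eq_add_of_le' hm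
  simp only [leading, Nat.add_sub_cancel, Finset.prod_range_succ, mul_assoc]

lemma leading_add (s₁ s₂ : ℕ) : leading n (s₁ + s₂ + 1) =
    leading n (s₂ + 1) * ∏ j ∈ Finset.range s₁, (root n - (-1) ^ (s₂ + 1 + j)) := by
  induction s₁ with
  | zero => simp
  | succ s₁ ih =>
    rw [show s₁ + 1 + s₂ + 1 = (s₁ + s₂ + 1) + 1 by ring, leading_succ (by omega), ih,
      Finset.prod_range_succ, mul_assoc, show s₁ + s₂ + 1 = s₂ + 1 + s₁ by ring]

/-- Neighbouring factors carry opposite signs and multiply to (x - 1)(x + 1), whatever p is. -/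
lemma prod_sub_sign_two_mul (x : ℂ) (p t : ℕ) :
    ∏ j ∈ Finset.range (2 * t), (x - (-1) ^ (p + j)) = (x ^ 2 - 1) ^ t := by
  induction t with
  | zero => simp
  | succ t ih =>
    rw [show 2 * (t + 1) = 2 * t + 1 + 1 by ring, Finset.prod_range_succ, Finset.prod_range_succ,
      ih, pow_succ _ t, mul_assoc]
    congr 1
    have h : ((-1 : ℂ) ^ (p + 2 * t)) ^ 2 = 1 := by rw [← pow_mul, mul_comm, pow_mul]; simp
    rw [← add_assoc, pow_succ]
    linear_combination -h

lemma prod_sub_sign_two_mul_add_one (x : ℂ) (p t : ℕ) :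
    ∏ j ∈ Finset.range (2 * t + 1), (x - (-1) ^ (p + j)) = (x ^ 2 - 1) ^ t * (x - (-1) ^ p) := by
  rw [Finset.prod_range_succ, prod_sub_sign_two_mul, pow_add, pow_mul]
  simp

/-- Both sides are the scalar of D^k S^m, m = s₁ + s₂ + 1, in (ad S)^(s₁) T_(s₂+1)^k. The powers of
(a^(2k) - 1)/(a^2 - 1) come from pairing neighbouring factors of the products for x = a^k and x = a;
for odd s₁ one factor is left over, with a sign given by the parity of s₂. -/
lemma coeff_mul (hn : 2 ≤ n) (k s₁ s₂ : ℕ) (h : s₁ + s₂ + 1 < 2 * n) :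
    coeff n k s₁ s₂ * (leading n (s₁ + s₂ + 1) * (1 - root n ^ (s₁ + s₂ + 1)) ^ (k - 1)) =
      leading n (s₂ + 1) * (1 - root n ^ (s₂ + 1)) ^ (k - 1) *
        ∏ j ∈ Finset.range s₁, (root n ^ k - (-1) ^ (s₂ + 1 + j)) := by
  have h1 : (1 - root n ^ (s₁ + s₂ + 1)) ^ (k - 1) ≠ 0 :=
    pow_ne_zero _ (one_sub_root_pow_ne_zero hn (by omega) h)
  have h2 : root n ^ 2 - 1 ≠ 0 := by
    rw [← neg_ne_zero, neg_sub]
    exact one_sub_root_pow_ne_zero hn (by omega) (by omega)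
  have hm : root n - 1 ≠ 0 := by simpa using root_sub_sign_ne_zero hn 0
  have hp : root n + 1 ≠ 0 := by simpa using root_sub_sign_ne_zero hn 1
  have hk : root n ^ (2 * k) = (root n ^ k) ^ 2 := by rw [← pow_mul, mul_comm]
  rw [leading_add]
  simp only [coeff, div_pow, hk]
  rcases Nat.even_or_odd' s₁ with ⟨t, rfl | rfl⟩
  · have e : (2 * t) / 2 = t := by omega
    rw [if_pos (even_two_mul t), prod_sub_sign_two_mul, prod_sub_sign_two_mul, e]
    have h3 : (root n ^ 2 - 1) ^ t ≠ 0 := pow_ne_zero _ h2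
    field_simp
  · have e : (2 * t + 1 - 1) / 2 = t := by omega
    rw [if_neg (by simp), prod_sub_sign_two_mul_add_one, prod_sub_sign_two_mul_add_one, e]
    have h3 : (root n ^ 2 - 1) ^ t ≠ 0 := pow_ne_zero _ h2
    split_ifs with hs
    · rw [hs.add_one.neg_one_pow]
      simp only [sub_neg_eq_add]
      field_simp
    · rw [(Nat.not_even_iff_odd.1 hs).add_one.neg_one_pow]
      field_simp

lemma coeff_one_mul (hn : 2 ≤ n) (k m : ℕ) (hm : 1 ≤ m) (h : m + 1 < 2 * n) :
    coeff n k 1 (m - 1) * (leading n (m + 1) * (1 - root n ^ (m + 1)) ^ (k - 1)) =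
      leading n m * (1 - root n ^ m) ^ (k - 1) * (root n ^ k - (-1) ^ m) := by
  obtain ⟨m, rfl⟩ := Nat.exists_eq_add_of_le' hm
  have := coeff_mul hn k 1 m (by omega)
  rw [show 1 + m + 1 = m + 1 + 1 by ring] at this
  simpa using this

end roots

/-! ### The matrices D^k S^m and the relations between D and S. -/

section matrices

variable {n : ℕ}

/-- The matrix `D^k S^m`. -/
def clockShift (n m k : ℕ) : SMat n := clock n ^ k * shift n ^ m

lemma clock_pow (k : ℕ) : clock n ^ k = Matrix.diagonal fun r : Fin (2 * n) => root n ^ (k * (r : ℕ)) := by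
  rw [clock, Matrix.diagonal_pow]
  congr 1
  ext r
  simp [← pow_mul, mul_comm]

lemma shift_pow_apply (m : ℕ) (r c : Fin (2 * n)) :
    (shift n ^ m) r c = if (c : ℕ) = ((r : ℕ) + m) % (2 * n) then 1 else 0 := by
  induction m generalizing c with
  | zero => simp [Matrix.one_apply, Fin.ext_iff, Nat.mod_eq_of_lt r.2, eq_comm]
  | succ m ih =>
    have hpos : 0 < 2 * n := by have := r.2; omega
    rw [pow_succ, Matrix.mul_apply, Finset.sum_eq_single ⟨(r + m) % (2 * n), Nat.mod_lt _ hpos⟩]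
    · rw [ih]
      simp [shift, add_assoc]
    · intro b _ hb
      rw [ih, if_neg (fun h => hb (Fin.ext h)), zero_mul]
    · simp

lemma clockShift_apply (m k : ℕ) (r c : Fin (2 * n)) : clockShift n m k r c =
    root n ^ (k * (r : ℕ)) * if (c : ℕ) = ((r : ℕ) + m) % (2 * n) then 1 else 0 := by
  rw [clockShift, clock_pow, Matrix.diagonal_mul, shift_pow_apply]

lemma clock_pow_two_mul (hn : 2 ≤ n) : clock n ^ (2 * n) = 1 := by
  rw [clock_pow]
  simp [pow_mul, root_pow_two_mul hn]

lemma shift_pow_two_mul : shift n ^ (2 * n) = 1 := by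
  ext r c
  rw [shift_pow_apply]
  simp [Matrix.one_apply, Fin.ext_iff, Nat.mod_eq_of_lt r.2, eq_comm]

lemma shift_mul_clock (hn : 2 ≤ n) : shift n * clock n = root n • (clock n * shift n) := by
  ext r c
  simp only [clock, Matrix.mul_diagonal, Matrix.smul_apply, Matrix.diagonal_mul, shift,
    Matrix.of_apply, smul_eq_mul]
  split_ifs with h
  · rw [h, one_mul, mul_one, ← pow_succ', ← pow_eq_pow_mod _ (root_pow_two_mul hn)]
  · simp

lemma shift_mul_clock_pow (hn : 2 ≤ n) (k : ℕ) :
    shift n * clock n ^ k = root n ^ k • (clock n ^ k * shift n) := by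
  induction k with
  | zero => simp
  | succ k ih =>
    rw [pow_succ, ← mul_assoc, ih, smul_mul_assoc, mul_assoc, shift_mul_clock hn, mul_smul_comm,
      smul_smul, ← mul_assoc, pow_succ]

lemma shift_pow_mul_clock (hn : 2 ≤ n) (m : ℕ) :
    shift n ^ m * clock n = root n ^ m • (clock n * shift n ^ m) := by
  induction m with
  | zero => simp
  | succ m ih =>
    rw [pow_succ', mul_assoc, ih, mul_smul_comm, ← mul_assoc, shift_mul_clock hn, smul_mul_assoc,
      smul_smul, mul_assoc, pow_succ]

lemma clockShift_mem (m k : ℕ) : clockShift n m k ∈ (part (m : ZMod 2) : Submodule ℂ (SMat n)) := by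
  have h1 : clock n ^ k ∈ (partM 0 : Submodule ℂ (SMat n)) := by
    intro r c h
    rw [clock_pow]
    refine Matrix.diagonal_apply_ne _ ?_
    rintro rfl
    exact h (CharTwo.add_self_eq_zero _)
  have h2 : shift n ^ m ∈ (partM (m : ZMod 2) : Submodule ℂ (SMat n)) := by
    induction m with
    | zero =>
      intro r c h
      rw [pow_zero]
      refine Matrix.one_apply_ne ?_
      rintro rfl
      exact h (by simpa using CharTwo.add_self_eq_zero _)
    | succ m ih =>
      rw [pow_succ, Nat.cast_succ]
      exact mul_mem_part ih (shift_mem n)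
  have := mul_mem_part h1 h2
  rwa [zero_add] at this

lemma ad_clock_clockShift (hn : 2 ≤ n) (m k : ℕ) :
    ad (clock n) (clockShift n m k) = (1 - root n ^ m) • clockShift n m (k + 1) := by
  have h := bracketM_of_mem (clock_mem n) (clockShift_mem (n := n) m k)
  refine h.trans ?_
  have hk : koszul 0 (m : ZMod 2) = 1 := by simp [koszul]
  rw [hk, one_smul, clockShift, mul_assoc, shift_pow_mul_clock hn, ← mul_assoc, mul_smul_comm,
    ← mul_assoc, ← pow_succ', ← pow_succ, sub_smul, one_smul, clockShift]

lemma ad_shift_clockShift (hn : 2 ≤ n) (m k : ℕ) :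
    ad (shift n) (clockShift n m k) = (root n ^ k - (-1) ^ m) • clockShift n (m + 1) k := by
  have h := bracketM_of_mem (shift_mem n) (clockShift_mem (n := n) m k)
  refine h.trans ?_
  have hk : koszul 1 (m : ZMod 2) = (-1) ^ m := by
    have := koszul_natCast 1 m
    simpa using this
  rw [hk, clockShift, mul_assoc, ← mul_assoc, shift_mul_clock_pow hn, smul_mul_assoc, mul_assoc,
    ← pow_succ', ← pow_succ, sub_smul, clockShift]

lemma clockShift_zero_one : clockShift n 0 1 = clock n := by simp [clockShift]

lemma clockShift_one_zero : clockShift n 1 0 = shift n := by simp [clockShift]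

lemma clockShift_add_left (m k : ℕ) : clockShift n (m + 2 * n) k = clockShift n m k := by
  rw [clockShift, pow_add, shift_pow_two_mul, mul_one, clockShift]

lemma clockShift_add_right (hn : 2 ≤ n) (m k : ℕ) :
    clockShift n m (k + 2 * n) = clockShift n m k := by
  rw [clockShift, pow_add, clock_pow_two_mul hn, mul_one, clockShift]

lemma ad_clock_pow_clockShift (hn : 2 ≤ n) (m k j : ℕ) :
    (ad (clock n) ^ j) (clockShift n m k) = (1 - root n ^ m) ^ j • clockShift n m (k + j) := by
  induction j with
  | zero => simp
  | succ j ih =>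
    rw [pow_succ', Module.End.mul_apply, ih, map_smul, ad_clock_clockShift hn, smul_smul,
      ← pow_succ, add_assoc]

lemma ad_shift_pow_clockShift (hn : 2 ≤ n) (m k j : ℕ) :
    (ad (shift n) ^ j) (clockShift n m k) =
      (∏ i ∈ Finset.range j, (root n ^ k - (-1) ^ (m + i))) • clockShift n (m + j) k := by
  induction j with
  | zero => simp
  | succ j ih =>
    rw [pow_succ', Module.End.mul_apply, ih, map_smul, ad_shift_clockShift hn, smul_smul,
      Finset.prod_range_succ, add_assoc]

lemma ad_clock_shift (hn : 2 ≤ n) :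
    ad (clock n) (shift n) = (1 - root n) • clockShift n 1 1 := by
  rw [← clockShift_one_zero, ad_clock_clockShift hn, pow_one]

lemma ad_shift_pow_ad_clock_shift (hn : 2 ≤ n) {m : ℕ} (hm : 1 ≤ m) :
    (ad (shift n) ^ (m - 1)) (ad (clock n) (shift n)) = leading n m • clockShift n m 1 := by
  rw [ad_clock_shift hn, map_smul, ad_shift_pow_clockShift hn, smul_smul, leading, pow_one]
  simp only [add_comm 1]
  rw [Nat.sub_add_cancel hm]

lemma T_clock_shift (hn : 2 ≤ n) {m k : ℕ} (hm : 1 ≤ m) (hm' : m < 2 * n) (hk : 1 ≤ k) :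
    T n (clock n) (shift n) m k =
      (leading n m * (1 - root n ^ m) ^ (k - 1)) • clockShift n m k := by
  rw [T, if_neg hm'.ne, ad_shift_pow_ad_clock_shift hn hm, map_smul, ad_clock_pow_clockShift hn,
    smul_smul, Nat.add_sub_of_le hk]

/-- The last bracket with S acts on the odd power S^(2n-1), whence the factor a^k + 1, and S^(2n) =
1 brings the exponent back to 0. -/
lemma T_clock_shift_last (hn : 2 ≤ n) {k : ℕ} (hk : 1 ≤ k) :
    T n (clock n) (shift n) (2 * n) k =
      (leading n (2 * n - 1) * (1 - root n ^ (2 * n - 1)) ^ (k - 1) * (root n ^ k + 1)) •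
        clockShift n 0 k := by
  have h := T_clock_shift hn (m := 2 * n - 1) (by omega) (by omega) hk
  rw [T, if_neg (by omega), show 2 * n - 1 - 1 = 2 * n - 2 by omega] at h
  have ho : Odd (2 * n - 1) := ⟨n - 1, by omega⟩
  rw [T, if_pos rfl, h, map_smul, ad_shift_clockShift hn, smul_smul, ho.neg_one_pow,
    sub_neg_eq_add, Nat.sub_add_cancel (by omega), ← clockShift_add_left 0, zero_add]

lemma leading_last (hn : 2 ≤ n) :
    leading n (2 * n - 1) = (1 - root n) * (root n ^ 2 - 1) ^ (n - 1) := by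
  rw [leading, show 2 * n - 1 - 1 = 2 * (n - 1) by omega, ← prod_sub_sign_two_mul _ 1]
  simp only [add_comm 1]

lemma leading_last_mul (hn : 2 ≤ n) :
    leading n (2 * n - 1) * (root n + 1) = (-1) ^ (n + 1) * (1 - root n ^ 2) ^ n := by
  rw [leading_last hn]
  obtain ⟨n, rfl⟩ := Nat.exists_eq_add_of_le' (show 1 ≤ n by omega)
  have e : (1 - root (n + 1) ^ 2) = (-1) * (root (n + 1) ^ 2 - 1) := by ring
  rw [e, mul_pow, ← mul_assoc, ← pow_add, show n + 1 + 1 + (n + 1) = 2 * (n + 1) + 1 by ring,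
    pow_succ (-1 : ℂ), pow_mul]
  simp only [Nat.add_sub_cancel]
  simp
  ring

theorem relation_clock_shift (hn : 2 ≤ n) {x y : SMat n}
    (h : Relation n (clock n) (shift n) x y) : x = y := by
  cases h with
  | rel1 =>
    rw [← clockShift_one_zero, ad_clock_pow_clockShift hn, clockShift_add_right hn, pow_one]
  | rel2 m h2 hm =>
    rw [ad_shift_pow_ad_clock_shift hn (by omega), map_smul, ad_clock_pow_clockShift hn,
      clockShift_add_right hn, smul_comm]
  | rel3 =>
    have h := T_clock_shift_last hn (k := 1) le_rfl
    rw [T, if_pos rfl] at h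
    rw [T, if_neg (by omega), show 2 * n - 1 - 1 = 2 * n - 2 by omega, h, clockShift_zero_one]
    rw [pow_one, Nat.sub_self, pow_zero, mul_one, ← leading_last_mul hn]
  | rel4 k h2 hk =>
    rw [T_clock_shift_last hn (by omega), T_clock_shift hn le_rfl (by omega) (by omega), map_smul,
      ad_shift_clockShift hn, smul_smul, smul_smul, leading_last hn, leading_one]
    congr 1
    have h := one_sub_root_ne_zero hn
    have h3 : (1 - root n) ^ (k - 1) ≠ 0 := pow_ne_zero _ h
    simp only [pow_one, div_pow, pow_zero, mul_comm 2 k, pow_mul]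
    field_simp
    ring
  | rel5 =>
    -- [S, S] = 2 S^2 and S^2 = D^(2n) S^2; the coefficient of T_2^(2n) is (1 - a)(1 + a)(1 -
    -- a^2)^(2n-1) = (1 - a^2)^(2n).
    have e := ad_shift_clockShift hn 1 0
    rw [clockShift_one_zero] at e
    have hz : clockShift n 2 (2 * n) = clockShift n 2 0 := by
      simpa using clockShift_add_right hn 2 0
    rw [e, T_clock_shift hn (by omega) (by omega) (by omega), leading_succ le_rfl, leading_one,
      smul_smul, hz]
    congr 1
    have h := one_sub_root_pow_ne_zero hn (m := 2) (by omega) (by omega)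
    rw [div_mul_eq_mul_div, eq_div_iff (pow_ne_zero _ h),
      ← pow_sub_one_mul (show 2 * n ≠ 0 by omega) (1 - root n ^ 2)]
    ring
  | path m k s₁ s₂ h2 hm hk1 hk hs₁ hs =>
    obtain rfl : m = s₁ + s₂ + 1 := by omega
    rw [T_clock_shift hn (by omega) (by omega) hk1, T_clock_shift hn (by omega) (by omega) hk1,
      map_smul, ad_shift_pow_clockShift hn, smul_smul, smul_smul, coeff_mul hn _ _ _ (by omega),
      show s₂ + 1 + s₁ = s₁ + s₂ + 1 by ring]

end matrices

end Sylvester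

/-! ### The basis of sl(n|n). -/

namespace Sylvester

open LieSuperalgebra SuperMatrix

section basis

variable {n : ℕ}

/-- The entry in row r and column r + m sees only the terms with that m. It is a polynomial of
degree less than 2n in a^r, vanishing at 2n distinct nodes, so Vandermonde applies. -/
lemma linearIndependent_clockShift (hn : 2 ≤ n) :
    LinearIndependent ℂ (fun q : Fin (2 * n) × Fin (2 * n) => clockShift n q.1 q.2) := by
  rw [Fintype.linearIndependent_iff]
  intro g hg q
  obtain ⟨m, k⟩ := q
  have key : (fun k => g (m, k)) = 0 := by
    apply Matrix.eq_zero_of_forall_index_sum_pow_mul_eq_zero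
      (f := fun r : Fin (2 * n) => root n ^ (r : ℕ))
    · intro r r' h
      exact Fin.ext ((isPrimitiveRoot_root hn).pow_inj r.2 r'.2 h)
    · intro r
      have h := congr_fun (congr_fun hg r) ⟨(r + m) % (2 * n), Nat.mod_lt _ (by omega)⟩
      rw [Fintype.sum_prod_type, Matrix.sum_apply, Finset.sum_eq_single m] at h
      · simpa [Matrix.sum_apply, clockShift_apply, ← pow_mul, mul_comm] using h
      · intro m' _ hm
        rw [Matrix.sum_apply]
        refine Finset.sum_eq_zero fun k' _ => ?_
        rw [Matrix.smul_apply, clockShift_apply, if_neg, mul_zero, smul_zero]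
        intro h'
        have h2 : (r + m : ℕ) ≡ r + m' [MOD 2 * n] := h'
        exact hm (Fin.ext (Nat.ModEq.add_left_cancel' _ h2 |>.symm.eq_of_lt_of_lt m'.2 m.2))
      · simp
  exact congr_fun key k

lemma span_clockShift (hn : 2 ≤ n) :
    Submodule.span ℂ (Set.range fun q : Fin (2 * n) × Fin (2 * n) => clockShift n q.1 q.2) = ⊤ := by
  refine (linearIndependent_clockShift hn).span_eq_top_of_card_eq_finrank' ?_
  simp [Module.finrank_matrix]

lemma supertrace_apply (M : SMat n) :
    supertrace n M = ∑ r : Fin (2 * n), (-1) ^ (r : ℕ) * M r r := by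
  simp [supertrace]

/-- For m ≠ 0 the diagonal is zero. For m = 0, writing (-1)^r = a^(nr) makes the supertrace a
geometric sum of ratio a^(n+k) over a full period; the ratio is 1 only for k = n. -/
lemma supertrace_clockShift (hn : 2 ≤ n) {m k : ℕ} (hm : m < 2 * n) (hk : k < 2 * n)
    (h : m = 0 → k ≠ n) : supertrace n (clockShift n m k) = 0 := by
  rw [supertrace_apply]
  by_cases h0 : m = 0
  · subst h0
    have e : ∀ r : Fin (2 * n), (-1 : ℂ) ^ (r : ℕ) * clockShift n 0 k r r =
        (root n ^ (n + k)) ^ (r : ℕ) := by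
      intro r
      rw [clockShift_apply, if_pos (by simp [Nat.mod_eq_of_lt r.2]), pow_add, root_pow_half hn,
        mul_pow, pow_mul, mul_one]
    rw [Finset.sum_congr rfl fun r _ => e r,
      Fin.sum_univ_eq_sum_range (fun r => (root n ^ (n + k)) ^ r)]
    have hne : root n ^ (n + k) - 1 ≠ 0 := by
      rw [sub_ne_zero]
      intro h1
      rw [(isPrimitiveRoot_root hn).pow_eq_one_iff_dvd] at h1
      obtain ⟨t, ht⟩ := h1
      have := h rfl
      have h1 : 0 < t := by
        rcases Nat.eq_zero_or_pos t with rfl | h1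
        · omega
        · exact h1
      have h2 : t < 2 := by
        by_contra! h2
        nlinarith
      obtain rfl : t = 1 := by omega
      omega
    refine (mul_eq_zero.1 ((geom_sum_mul _ _).trans ?_)).resolve_right hne
    rw [← pow_mul, mul_comm, pow_mul, root_pow_two_mul hn, one_pow, sub_self]
  · refine Finset.sum_eq_zero fun r _ => ?_
    rw [clockShift_apply, if_neg, mul_zero, mul_zero]
    intro h'
    have h2 : (r + 0 : ℕ) ≡ r + m [MOD 2 * n] := by
      rw [Nat.ModEq, ← h']
      simp [Nat.mod_eq_of_lt r.2]
    exact h0 (Nat.ModEq.add_left_cancel' _ h2 |>.symm.eq_of_lt_of_lt hm (by omega))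

lemma supertrace_clockShift_zero (hn : 2 ≤ n) : supertrace n (clockShift n 0 n) = 2 * n := by
  rw [supertrace_apply]
  have e : ∀ r : Fin (2 * n), (-1 : ℂ) ^ (r : ℕ) * clockShift n 0 n r r = 1 := by
    intro r
    rw [clockShift_apply, if_pos (by simp [Nat.mod_eq_of_lt r.2]), pow_mul, root_pow_half hn,
      mul_one, ← mul_pow]
    simp
  simp [e]

/-- A nonzero product M r c * N c r forces i and j to be the parity of r + c. The Koszul sign is
then (-1)^(r+c), exactly the ratio of the signs of the diagonal positions r and c. -/
lemma supertrace_mul_comm {i j : ZMod 2} {M N : SMat n} (hM : M ∈ partM i) (hN : N ∈ partM j) :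
    supertrace n (M * N) = koszul i j * supertrace n (N * M) := by
  simp only [supertrace_apply, Matrix.mul_apply, Finset.mul_sum]
  rw [Finset.sum_comm]
  refine Finset.sum_congr rfl fun c _ => Finset.sum_congr rfl fun r _ => ?_
  by_cases h1 : par r + par c = i
  · by_cases h2 : par c + par r = j
    · have e1 : i = ((r + c : ℕ) : ZMod 2) := by rw [← h1]; simp [par]
      have e2 : j = ((r + c : ℕ) : ZMod 2) := by rw [← h2]; simp [par, add_comm]
      have e3 : (-1 : ℂ) ^ ((r + c : ℕ) * (r + c : ℕ)) = (-1) ^ (r : ℕ) * (-1) ^ (c : ℕ) := by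
        rw [← pow_add]
        rcases Nat.even_or_odd (r + c : ℕ) with h | h
        · rw [h.neg_one_pow, (h.mul_left _).neg_one_pow]
        · rw [h.neg_one_pow, (h.mul h).neg_one_pow]
      have e4 : (-1 : ℂ) ^ (c : ℕ) * (-1) ^ (c : ℕ) = 1 := by rw [← mul_pow]; simp
      rw [e1, e2, koszul_natCast, e3]
      linear_combination -(-1) ^ (r : ℕ) * M r c * N c r * e4
    · rw [hN c r h2]; simp
  · rw [hM r c h1]; simp

lemma supertrace_ad (M N : SMat n) : supertrace n (ad M N) = 0 := by
  obtain ⟨x₀, h₀, x₁, h₁, rfl⟩ := exists_decomp M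
  obtain ⟨y₀, k₀, y₁, k₁, rfl⟩ := exists_decomp N
  have key : ∀ {i j : ZMod 2} {u v : SMat n}, u ∈ (part i : Submodule ℂ (SMat n)) →
      v ∈ (part j : Submodule ℂ (SMat n)) → supertrace n (bracket u v) = 0 := by
    intro i j u v hu hv
    have h := bracketM_of_mem hu hv
    rw [show bracket u v = _ from h, map_sub, map_smul, supertrace_mul_comm hu hv, smul_eq_mul,
      sub_self]
  simp only [ad, map_add, LinearMap.add_apply, key h₀ k₀, key h₀ k₁, key h₁ k₀, key h₁ k₁,
    add_zero]

lemma isSubalgebra_sl : IsSubalgebra (sl n) := by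
  refine ⟨isGraded_iff.2 fun x₀ _ x₁ h₁ hx => ?_, fun x _ y _ => supertrace_ad x y⟩
  -- An odd matrix has zero diagonal.
  have h : x₁ ∈ sl n := by
    change supertrace n x₁ = 0
    rw [supertrace_apply]
    refine Finset.sum_eq_zero fun r _ => ?_
    rw [h₁ r r, mul_zero]
    rw [CharTwo.add_self_eq_zero]
    decide
  exact ⟨by simpa using sub_mem hx h, h⟩

variable (n) in
/-- `D`, `S` and the `T_m^k`, without the vanishing `T_(2n)^n`. -/
def generatorFamily {L : Type*} [AddCommGroup L] [Module ℂ L] [LieSuperalgebra L] (d s : L) :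
    Fin 2 ⊕ ↥(indexSet n \ {(2 * n, n)}) → L :=
  Sum.elim ![d, s] (fun q => T n d s q.1.1 q.1.2)

/-- The map φ reduces both indices modulo 2n. The slots (0, 1) and (1, 0) would belong to T_(2n)^1
and T_1^(2n), the two pairs left out of `indexSet`, and are taken by D and S; only D^n, the slot of
T_(2n)^n, stays empty. -/
lemma exists_clockShift_eq (hn : 2 ≤ n) :
    ∃ (φ : Fin 2 ⊕ ↥(indexSet n \ {(2 * n, n)}) → Fin (2 * n) × Fin (2 * n))
      (c : Fin 2 ⊕ ↥(indexSet n \ {(2 * n, n)}) → ℂˣ), Function.Injective φ ∧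
      (Set.range φ = {q | ¬(q.1.1 = 0 ∧ q.2.1 = n)}) ∧
      generatorFamily n (clock n) (shift n) =
        c • (fun i => clockShift n (φ i).1 (φ i).2) := by
  have hmod : ∀ k : ℕ, k % (2 * n) < 2 * n := fun k => Nat.mod_lt _ (by omega)
  have hself : ∀ k : ℕ, 1 ≤ k → k ≤ 2 * n → k = k % (2 * n) ∨ (k = 2 * n ∧ k % (2 * n) = 0) := by
    intro k h1 h2
    rcases h2.lt_or_eq with h | h
    · exact .inl (Nat.mod_eq_of_lt h).symm
    · subst h; simp
  let φ : Fin 2 ⊕ ↥(indexSet n \ {(2 * n, n)}) → Fin (2 * n) × Fin (2 * n) :=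
    Sum.elim ![(⟨0, by omega⟩, ⟨1, by omega⟩), (⟨1, by omega⟩, ⟨0, by omega⟩)]
      (fun q => (⟨q.1.1 % (2 * n), hmod _⟩, ⟨q.1.2 % (2 * n), hmod _⟩))
  have hc : ∀ i, ∃ c : ℂˣ, generatorFamily n (clock n) (shift n) i =
      c • clockShift n (φ i).1 (φ i).2 := by
    rintro (i | ⟨⟨m, k⟩, ⟨h1, h2, h3, h4, h5, h6⟩, h7⟩)
    · refine ⟨1, ?_⟩
      fin_cases i
      · simp [generatorFamily, φ, clockShift_zero_one]
      · simp [generatorFamily, φ, clockShift_one_zero]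
    · simp only at h1 h2 h3 h4 h5 h6
      have hk : clockShift n m k = clockShift n m (k % (2 * n)) := by
        rcases hself k h3 h4 with h | ⟨h, h'⟩
        · rw [← h]
        · rw [h', h]; simpa using clockShift_add_right hn m 0
      have hm : clockShift n m k = clockShift n (m % (2 * n)) (k % (2 * n)) := by
        rw [hk]
        rcases hself m h1 h2 with h | ⟨h, h'⟩
        · rw [← h]
        · rw [h', h]; simpa using clockShift_add_left (n := n) 0 (k % (2 * n))
      rcases h2.lt_or_eq with h | h
      · refine ⟨Units.mk0 (leading n m * (1 - root n ^ m) ^ (k - 1)) ?_, ?_⟩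
        · exact mul_ne_zero (leading_ne_zero hn m)
            (pow_ne_zero _ (one_sub_root_pow_ne_zero hn h1 h))
        · change T n (clock n) (shift n) m k = _ • clockShift n (m % (2 * n)) (k % (2 * n))
          rw [T_clock_shift hn h1 h h3, ← hm]
          rfl
      · subst h
        refine ⟨Units.mk0 (leading n (2 * n - 1) * (1 - root n ^ (2 * n - 1)) ^ (k - 1) *
          (root n ^ k + 1)) ?_, ?_⟩
        · refine mul_ne_zero (mul_ne_zero (leading_ne_zero hn _)
            (pow_ne_zero _ (one_sub_root_pow_ne_zero hn (by omega) (by omega)))) ?_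
          -- If a^k = -1 = a^n with k < 2n then k = n, which is excluded; for k = 2n the factor is
          -- 2.
          intro h0
          have h8 : k ≠ n := fun e => h7 (by simp [e])
          rcases h4.lt_or_eq with h9 | h9
          · have h10 : root n ^ k = root n ^ n := by
              rw [root_pow_half hn]; exact eq_neg_of_add_eq_zero_left h0
            exact h8 ((isPrimitiveRoot_root hn).pow_inj h9 (by omega) h10)
          · rw [h9, root_pow_two_mul hn] at h0
            norm_num at h0
        · change T n (clock n) (shift n) (2 * n) k =
            _ • clockShift n (2 * n % (2 * n)) (k % (2 * n))
          rw [T_clock_shift_last hn h3, ← hm]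
          have := clockShift_add_left (n := n) 0 k
          rw [zero_add] at this
          rw [this]
          rfl
  choose c hc using hc
  refine ⟨φ, c, ?_, ?_, funext hc⟩
  · rintro (i | ⟨⟨m, k⟩, ⟨h1, h2, h3, h4, h5, h6⟩, h7⟩)
      (j | ⟨⟨m', k'⟩, ⟨h1', h2', h3', h4', h5', h6'⟩, h7'⟩) h
    · congr 1
      fin_cases i <;> fin_cases j <;> simp [φ] at h ⊢
    · exfalso
      simp only at h1' h2' h3' h4' h5' h6'
      have hk := hself k' h3' h4'
      have hm := hself m' h1' h2'
      fin_cases i <;> simp [φ, Prod.ext_iff, Fin.ext_iff] at h <;> omega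
    · exfalso
      simp only at h1 h2 h3 h4 h5 h6
      have hk := hself k h3 h4
      have hm := hself m h1 h2
      fin_cases j <;> simp [φ, Prod.ext_iff, Fin.ext_iff] at h <;> omega
    · simp only at h1 h2 h3 h4 h5 h6 h1' h2' h3' h4' h5' h6'
      have hk := hself k h3 h4
      have hm := hself m h1 h2
      have hk' := hself k' h3' h4'
      have hm' := hself m' h1' h2'
      simp only [φ, Sum.elim_inr, Prod.mk.injEq, Fin.mk.injEq] at h
      obtain ⟨rfl, rfl⟩ : m = m' ∧ k = k' := by omega
      rfl
  · ext ⟨m, k⟩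
    simp only [Set.mem_range, Set.mem_ofPred_eq]
    constructor
    · rintro ⟨i | ⟨⟨m', k'⟩, ⟨h1', h2', h3', h4', h5', h6'⟩, h7'⟩, h⟩
      · fin_cases i <;> simp [φ, Prod.ext_iff, Fin.ext_iff] at h <;> omega
      · simp only [φ, Sum.elim_inr, Prod.mk.injEq, Fin.ext_iff] at h
        simp only at h1' h2' h3' h4' h5' h6'
        have hk' := hself k' h3' h4'
        have hm' := hself m' h1' h2'
        simp only [Set.mem_singleton_iff, Prod.mk.injEq] at h7'
        omega
    · intro h
      by_cases hD : m.1 = 0 ∧ k.1 = 1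
      · exact ⟨.inl 0, by simp [φ, Prod.ext_iff, Fin.ext_iff, hD]⟩
      by_cases hS : m.1 = 1 ∧ k.1 = 0
      · exact ⟨.inl 1, by simp [φ, Prod.ext_iff, Fin.ext_iff, hS]⟩
      have lift : ∀ m : Fin (2 * n), ∃ m' : ℕ, 1 ≤ m' ∧ m' ≤ 2 * n ∧ m' % (2 * n) = m ∧
          (m.1 = 0 → m' = 2 * n) ∧ (m.1 ≠ 0 → m' = m) := by
        intro m
        by_cases h : m.1 = 0
        · exact ⟨2 * n, by omega, by omega, by simp [h], by simp, by simp [h]⟩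
        · exact ⟨m, by omega, m.2.le, Nat.mod_eq_of_lt m.2, by simp [h], by simp⟩
      obtain ⟨m', a1, a2, a3, a4, a5⟩ := lift m
      obtain ⟨k', b1, b2, b3, b4, b5⟩ := lift k
      refine ⟨.inr ⟨(m', k'), ⟨a1, a2, b1, b2, ?_, ?_⟩, ?_⟩, ?_⟩
      · simp only; omega
      · simp only; omega
      · simp only [Set.mem_singleton_iff, Prod.mk.injEq]; omega
      · simp [φ, a3, b3]

theorem linearIndependent_generatorFamily (hn : 2 ≤ n) :
    LinearIndependent ℂ (generatorFamily n (clock n) (shift n)) := by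
  obtain ⟨φ, c, hφ, -, h⟩ := exists_clockShift_eq hn
  rw [h]
  exact ((linearIndependent_clockShift hn).comp φ hφ).units_smul c

theorem span_generatorFamily (hn : 2 ≤ n) :
    Submodule.span ℂ (Set.range (generatorFamily n (clock n) (shift n))) = sl n := by
  obtain ⟨φ, c, hφ, hr, h⟩ := exists_clockShift_eq hn
  have hi : ∀ i, generatorFamily n (clock n) (shift n) i =
      (c i : ℂ) • clockShift n (φ i).1 (φ i).2 := fun i => by rw [h]; rfl
  apply le_antisymm
  · rw [Submodule.span_le]
    rintro _ ⟨i, rfl⟩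
    rw [hi]
    refine Submodule.smul_mem _ _ (supertrace_clockShift hn (φ i).1.2 (φ i).2.2 ?_)
    have h2 : φ i ∈ {q : Fin (2 * n) × Fin (2 * n) | ¬(q.1.1 = 0 ∧ q.2.1 = n)} :=
      hr ▸ Set.mem_range_self i
    exact fun h3 h4 => h2 ⟨h3, h4⟩
  · intro x hx
    have hmem : ∀ q : Fin (2 * n) × Fin (2 * n), ¬(q.1.1 = 0 ∧ q.2.1 = n) →
        clockShift n q.1 q.2 ∈
          Submodule.span ℂ (Set.range (generatorFamily n (clock n) (shift n))) := by
      intro q hq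
      have h2 : q ∈ Set.range φ := hr ▸ hq
      obtain ⟨i, rfl⟩ := h2
      have h3 : clockShift n (φ i).1 (φ i).2 =
          (c i : ℂ)⁻¹ • generatorFamily n (clock n) (shift n) i := by
        rw [hi, smul_smul, inv_mul_cancel₀ (c i).ne_zero, one_smul]
      rw [h3]
      exact Submodule.smul_mem _ _ (Submodule.subset_span ⟨i, rfl⟩)
    have htop : x ∈ Submodule.span ℂ
        (Set.range fun q : Fin (2 * n) × Fin (2 * n) => clockShift n q.1 q.2) := by
      rw [span_clockShift hn]; trivial
    obtain ⟨g, rfl⟩ := (Submodule.mem_span_range_iff_exists_fun ℂ).1 htop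
    let q₀ : Fin (2 * n) × Fin (2 * n) := (⟨0, by omega⟩, ⟨n, by omega⟩)
    have hq₀ : ∀ q, q ≠ q₀ → ¬(q.1.1 = 0 ∧ q.2.1 = n) := by
      rintro q hq ⟨h1, h2⟩
      exact hq (Prod.ext (Fin.ext h1) (Fin.ext h2))
    -- D^n alone has nonzero supertrace, so supertrace zero means that its coefficient vanishes.
    have hg : g q₀ = 0 := by
      change supertrace n _ = 0 at hx
      rw [map_sum, Finset.sum_eq_single q₀] at hx
      · rw [map_smul, supertrace_clockShift_zero hn] at hx
        refine (smul_eq_zero.1 hx).resolve_right ?_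
        have : (n : ℂ) ≠ 0 := by exact_mod_cast (by omega : n ≠ 0)
        simpa using this
      · intro q _ hq
        rw [map_smul, supertrace_clockShift hn q.1.2 q.2.2
          (fun h3 h4 => hq₀ q hq ⟨h3, h4⟩), smul_zero]
      · simp
    refine Submodule.sum_mem _ fun q _ => ?_
    by_cases hq : q = q₀
    · rw [hq, hg, zero_smul]; exact zero_mem _
    · exact Submodule.smul_mem _ _ (hmem q (hq₀ q hq))

lemma T_last_half_eq_zero (hn : 2 ≤ n) : T n (clock n) (shift n) (2 * n) n = 0 := by
  rw [T_clock_shift_last hn (by omega), root_pow_half hn]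
  simp

theorem sl_eq_span (hn : 2 ≤ n) : sl n = Submodule.span ℂ ({clock n, shift n} ∪
    (fun q : ℕ × ℕ => T n (clock n) (shift n) q.1 q.2) '' indexSet n) := by
  rw [← span_generatorFamily hn]
  apply le_antisymm
  · refine Submodule.span_mono ?_
    rintro _ ⟨i | q, rfl⟩
    · left
      fin_cases i <;> simp [generatorFamily]
    · exact .inr ⟨q.1, q.2.1, rfl⟩
  · rw [Submodule.span_le]
    rintro _ ((rfl | rfl) | ⟨q, hq, rfl⟩)
    · exact Submodule.subset_span ⟨.inl 0, rfl⟩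
    · exact Submodule.subset_span ⟨.inl 1, rfl⟩
    · by_cases h : q = (2 * n, n)
      · subst h
        simp only [T_last_half_eq_zero hn]
        exact zero_mem _
      · exact Submodule.subset_span ⟨.inr ⟨q, hq, h⟩, rfl⟩

lemma generatorFamily_mem {L : Type*} [AddCommGroup L] [Module ℂ L] [LieSuperalgebra L] {d s : L}
    {W : Submodule ℂ L} (hd : d ∈ W) (hs : s ∈ W) (sd : ∀ x ∈ W, ad d x ∈ W)
    (ss : ∀ x ∈ W, ad s x ∈ W) (i) : generatorFamily n d s i ∈ W := by
  have hpow : ∀ (x : L), (∀ w ∈ W, ad x w ∈ W) → ∀ (k : ℕ), ∀ w ∈ W, (ad x ^ k) w ∈ W := by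
    intro x hx k
    induction k with
    | zero => simp
    | succ k ih =>
      intro w hw
      rw [pow_succ', Module.End.mul_apply]
      exact hx _ (ih w hw)
  rcases i with i | q
  · fin_cases i
    · exact hd
    · exact hs
  · change T n d s _ _ ∈ W
    unfold T
    split_ifs
    · exact ss _ (hpow d sd _ _ (hpow s ss _ _ (sd _ hs)))
    · exact hpow d sd _ _ (hpow s ss _ _ (sd _ hs))

theorem generated_eq_sl (hn : 2 ≤ n) : generated {clock n, shift n} = sl n := by
  have hD : clock n ∈ sl n := by
    rw [← span_generatorFamily hn]; exact Submodule.subset_span ⟨.inl 0, rfl⟩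
  have hS : shift n ∈ sl n := by
    rw [← span_generatorFamily hn]; exact Submodule.subset_span ⟨.inl 1, rfl⟩
  apply le_antisymm
  · refine sInf_le ⟨?_, isSubalgebra_sl⟩
    rintro _ (rfl | rfl)
    · exact hD
    · exact hS
  · refine le_sInf ?_
    rintro W ⟨h1, -, h2⟩
    have hd : clock n ∈ W := h1 (by simp)
    have hs : shift n ∈ W := h1 (by simp)
    rw [← span_generatorFamily hn, Submodule.span_le]
    rintro _ ⟨i, rfl⟩
    exact generatorFamily_mem hd hs (h2 _ hd) (h2 _ hs) i

end basis

end Sylvester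

/-! ### Abstract matrix units and the two hidden consequences of the relations. -/

namespace Sylvester

open LieSuperalgebra SuperMatrix

/-- Eigenspaces for distinct eigenvalues are independent, so equal sums agree term by term. With f =
ad d, this extracts a single bracket [E_(i,i+1), x] from [s, x]. -/
lemma eq_of_sum_eq_of_eigen {V ι : Type*} [AddCommGroup V] [Module ℂ V] [Fintype ι]
    (f : Module.End ℂ V) {μ : ι → ℂ} (hμ : Function.Injective μ) {v w : ι → V}
    (hv : ∀ i, f (v i) = μ i • v i) (hw : ∀ i, f (w i) = μ i • w i)
    (h : ∑ i, v i = ∑ i, w i) (i : ι) : v i = w i := by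
  have hind : iSupIndep (fun i => f.eigenspace (μ i)) := f.eigenspaces_iSupIndep.comp hμ
  exact ((iSupIndep_iff_finsetSum_eq_imp_eq _).1 hind) Finset.univ v w
    (fun i _ => ⟨Module.End.mem_eigenspace_iff.2 (hv i), Module.End.mem_eigenspace_iff.2 (hw i)⟩)
    h i (Finset.mem_univ i)

variable {n : ℕ} [NeZero (2 * n)]

variable (n) in
/-- The additive character of `ℤ/2n` with `1 ↦ a`. -/
abbrev chi : AddChar (ZMod (2 * n)) ℂ := ZMod.stdAddChar

lemma chi_one : chi n 1 = root n := by
  have := ZMod.stdAddChar_coe (N := 2 * n) 1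
  simpa [root] using this

lemma chi_natCast (k : ℕ) : chi n (k : ZMod (2 * n)) = root n ^ k := by
  rw [← chi_one, ← AddChar.map_nsmul_eq_pow, nsmul_one]

lemma chi_ne_zero (i : ZMod (2 * n)) : chi n i ≠ 0 := by
  intro h
  have := AddChar.map_add_eq_mul (chi n) i (-i)
  rw [h, zero_mul, add_neg_cancel, AddChar.map_zero_eq_one] at this
  exact one_ne_zero this

lemma chi_add_natCast (i : ZMod (2 * n)) (k : ℕ) : chi n (i + k) = chi n i * root n ^ k := by
  rw [AddChar.map_add_eq_mul, chi_natCast]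

lemma chi_add_one (i : ZMod (2 * n)) : chi n (i + 1) = chi n i * root n := by
  rw [AddChar.map_add_eq_mul, chi_one]

lemma chi_sub_one (i : ZMod (2 * n)) : chi n (i - 1) * root n = chi n i := by
  rw [← chi_add_one, sub_add_cancel]

lemma sum_chi_pow_mul {k l : ℕ} (hk : k < 2 * n) (hl : l < 2 * n) :
    ∑ i, chi n i ^ k * chi n (-i) ^ l = if k = l then (2 * n : ℂ) else 0 := by
  have h := AddChar.sum_mulShift (ψ := chi n) ((k : ZMod (2 * n)) - l)
    (ZMod.isPrimitive_stdAddChar (2 * n))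
  have e : ∀ i : ZMod (2 * n), chi n i ^ k * chi n (-i) ^ l = chi n (i * ((k : ZMod (2 * n)) - l)) := by
    intro i
    rw [← AddChar.map_nsmul_eq_pow, ← AddChar.map_nsmul_eq_pow, ← AddChar.map_add_eq_mul]
    congr 1
    simp only [nsmul_eq_mul]
    ring
  rw [Finset.sum_congr rfl fun i _ => e i, h]
  have h2 : ((k : ZMod (2 * n)) - l = 0) ↔ k = l := by
    rw [sub_eq_zero, ZMod.natCast_eq_natCast_iff]
    exact ⟨fun h => h.eq_of_lt_of_lt hk hl, fun h => h ▸ rfl⟩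
  simp only [h2, ZMod.card]
  split_ifs <;> simp

variable {L : Type*} [AddCommGroup L] [Module ℂ L] [LieSuperalgebra L]

variable (n) in
/-- Elements `Y m k` of a Lie superalgebra behaving like the matrices `D^k S^m`, `1 ≤ m < 2n`. -/
structure ClockShiftSystem (d s : L) (Y : ℕ → ℕ → L) : Prop where
  two_le : 2 ≤ n
  d_mem : d ∈ (part 0 : Submodule ℂ L)
  s_mem : s ∈ (part 1 : Submodule ℂ L)
  mem : ∀ (m : ℕ) k, 1 ≤ m → Y m k ∈ (part (m : ZMod 2) : Submodule ℂ L)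
  ad_d : ∀ m k, 1 ≤ m → m < 2 * n → ad d (Y m k) = (1 - root n ^ m) • Y m (k + 1)
  periodic : ∀ m k, 1 ≤ m → m < 2 * n → Y m (k + 2 * n) = Y m k
  ad_s : ∀ m k, 1 ≤ m → m + 1 < 2 * n → k < 2 * n →
    ad s (Y m k) = (root n ^ k - (-1) ^ m) • Y (m + 1) k
  one_zero : Y 1 0 = s
  ad_s_last : ad s (Y (2 * n - 1) 1) = (root n + 1) • d

variable (n) in
/-- The analogue of the matrix unit at row `i` and column `i + m`. -/
def matUnit (Y : ℕ → ℕ → L) (m : ℕ) (i : ZMod (2 * n)) : L :=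
  (2 * n : ℂ)⁻¹ • ∑ k ∈ Finset.range (2 * n), chi n (-i) ^ k • Y m k

namespace ClockShiftSystem

variable {d s : L} {Y : ℕ → ℕ → L} (h : ClockShiftSystem n d s Y)

include h

lemma unit_mem {m : ℕ} (hm : 1 ≤ m) (i : ZMod (2 * n)) :
    matUnit n Y m i ∈ (part (m : ZMod 2) : Submodule ℂ L) :=
  Submodule.smul_mem _ _ (Submodule.sum_mem _ fun k _ => Submodule.smul_mem _ _ (h.mem m k hm))

/-- Fourier inversion on ℤ/2n. -/
lemma sum_chi_pow_smul_unit (m : ℕ) {k : ℕ} (hk : k < 2 * n) :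
    ∑ i, chi n i ^ k • matUnit n Y m i = Y m k := by
  simp only [matUnit, Finset.smul_sum, smul_smul]
  rw [Finset.sum_comm, Finset.sum_eq_single k]
  · rw [← Finset.sum_smul]
    have e : ∀ i, chi n i ^ k * ((2 * n : ℂ)⁻¹ * chi n (-i) ^ k) =
        (2 * n : ℂ)⁻¹ * (chi n i ^ k * chi n (-i) ^ k) := fun i => by ring
    simp only [e]
    rw [← Finset.mul_sum, sum_chi_pow_mul hk hk, if_pos rfl, inv_mul_cancel₀ (two_mul_cast_ne_zero h.two_le),
      one_smul]
  · intro l hl hlk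
    rw [← Finset.sum_smul]
    have e : ∀ i, chi n i ^ k * ((2 * n : ℂ)⁻¹ * chi n (-i) ^ l) =
        (2 * n : ℂ)⁻¹ * (chi n i ^ k * chi n (-i) ^ l) := fun i => by ring
    simp only [e]
    rw [← Finset.mul_sum, sum_chi_pow_mul hk (Finset.mem_range.1 hl), if_neg hlk.symm, mul_zero,
      zero_smul]
  · intro hk'
    exact absurd (Finset.mem_range.2 hk) hk'

lemma sum_unit_one : ∑ i, matUnit n Y 1 i = s := by
  have := h.sum_chi_pow_smul_unit 1 (k := 0) (by have := h.two_le; omega)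
  simpa [h.one_zero] using this

/-- Apart from the scalar 1 - a^m, ad d shifts k by one; the Fourier transform turns this into
multiplication by χ(i), periodicity in k closing the sum. The weight is χ(i) - χ(i + m), as for a
matrix unit. -/
lemma ad_d_unit {m : ℕ} (hm : 1 ≤ m) (hm' : m < 2 * n) (i : ZMod (2 * n)) :
    ad d (matUnit n Y m i) = ((1 - root n ^ m) * chi n i) • matUnit n Y m i := by
  have hinv : chi n i * chi n (-i) = 1 := by
    rw [← AddChar.map_add_eq_mul, add_neg_cancel, AddChar.map_zero_eq_one]
  have hN : chi n (-i) ^ (2 * n) = 1 := by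
    rw [← AddChar.map_nsmul_eq_pow, nsmul_eq_mul, ZMod.natCast_self, zero_mul,
      AddChar.map_zero_eq_one]
  have hshift : ∑ k ∈ Finset.range (2 * n), chi n (-i) ^ (k + 1) • Y m (k + 1) =
      ∑ k ∈ Finset.range (2 * n), chi n (-i) ^ k • Y m k := by
    have e := Finset.sum_range_succ (fun k => chi n (-i) ^ k • Y m k) (2 * n)
    rw [Finset.sum_range_succ', hN] at e
    have hp := h.periodic m 0 hm hm'
    rw [zero_add] at hp
    rw [hp, pow_zero] at e
    exact add_right_cancel e
  rw [matUnit, map_smul, map_sum, smul_comm]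
  congr 1
  rw [← hshift, Finset.smul_sum]
  refine Finset.sum_congr rfl fun k _ => ?_
  rw [map_smul, h.ad_d m k hm hm', smul_smul, smul_smul]
  congr 1
  linear_combination -(1 - root n ^ m) * chi n (-i) ^ k * hinv

lemma ad_s_unit {m : ℕ} (hm : 1 ≤ m) (hm' : m + 1 < 2 * n) (i : ZMod (2 * n)) :
    ad s (matUnit n Y m i) =
      matUnit n Y (m + 1) (i - 1) - (-1 : ℂ) ^ m • matUnit n Y (m + 1) i := by
  simp only [matUnit, map_smul, map_sum]
  rw [smul_comm ((-1 : ℂ) ^ m), ← smul_sub]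
  congr 1
  rw [Finset.smul_sum, ← Finset.sum_sub_distrib]
  refine Finset.sum_congr rfl fun k hk => ?_
  rw [h.ad_s m k hm hm' (Finset.mem_range.1 hk), smul_smul, smul_smul, ← sub_smul, neg_sub, sub_eq_neg_add 1 i,
    chi_add_one, mul_pow]
  congr 1
  ring

lemma ad_d_ad_unit {m : ℕ} (hm : 1 ≤ m) (hm' : m < 2 * n) (i j : ZMod (2 * n)) :
    ad d (ad (matUnit n Y 1 i) (matUnit n Y m j)) =
      ((1 - root n) * chi n i + (1 - root n ^ m) * chi n j) •
        ad (matUnit n Y 1 i) (matUnit n Y m j) := by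
  rw [ad_ad_even h.d_mem (h.unit_mem le_rfl i), h.ad_d_unit le_rfl (by omega), h.ad_d_unit hm hm',
    map_smul, ad_smul_left, ← add_smul, pow_one]

lemma sum_ad_unit_one (x : L) : ∑ i, ad (matUnit n Y 1 i) x = ad s x := by
  conv_rhs => rw [← h.sum_unit_one]
  simp [ad]

/-- For fixed j the brackets have distinct ad d weights as i varies, and their sum over i is [s,
E_(j,j+m)]. The two terms of `ad_s_unit` have the weights belonging to i = j - 1 and i = j + m. -/
lemma ad_unit_one {m : ℕ} (hm : 1 ≤ m) (hm' : m + 1 < 2 * n) (i j : ZMod (2 * n)) :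
    ad (matUnit n Y 1 i) (matUnit n Y m j) =
      (if i = j - 1 then matUnit n Y (m + 1) (j - 1) else 0) -
        (-1 : ℂ) ^ m • (if i = j + m then matUnit n Y (m + 1) j else 0) := by
  refine eq_of_sum_eq_of_eigen (ad d)
    (μ := fun i => (1 - root n) * chi n i + (1 - root n ^ m) * chi n j) ?_
    (v := fun i => ad (matUnit n Y 1 i) (matUnit n Y m j))
    (w := fun i => (if i = j - 1 then matUnit n Y (m + 1) (j - 1) else 0) -
        (-1 : ℂ) ^ m • (if i = j + m then matUnit n Y (m + 1) j else 0)) ?_ ?_ ?_ i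
  · intro i i' e
    exact ZMod.injective_stdAddChar
      (mul_left_cancel₀ (one_sub_root_ne_zero h.two_le) (add_right_cancel e))
  · exact fun i => h.ad_d_ad_unit hm (by omega) i j
  · intro i
    have e1 : ad d (if i = j - 1 then matUnit n Y (m + 1) (j - 1) else 0) =
        ((1 - root n) * chi n i + (1 - root n ^ m) * chi n j) •
          (if i = j - 1 then matUnit n Y (m + 1) (j - 1) else 0) := by
      split_ifs with hi
      · rw [h.ad_d_unit (by omega) hm', hi]
        congr 1
        rw [← chi_sub_one j]
        ring
      · simp
    have e2 : ad d (if i = j + m then matUnit n Y (m + 1) j else 0) =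
        ((1 - root n) * chi n i + (1 - root n ^ m) * chi n j) •
          (if i = j + m then matUnit n Y (m + 1) j else 0) := by
      split_ifs with hi
      · rw [h.ad_d_unit (by omega) hm', hi, chi_add_natCast]
        congr 1
        ring
      · simp
    rw [map_sub, map_smul, e1, e2, smul_sub, smul_comm ((-1 : ℂ) ^ m)]
  · rw [h.sum_ad_unit_one, h.ad_s_unit hm hm', Finset.sum_sub_distrib, ← Finset.smul_sum]
    simp

lemma ad_unit_one_left {m : ℕ} (hm : 1 ≤ m) (hm' : m + 1 < 2 * n) (j : ZMod (2 * n)) :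
    ad (matUnit n Y 1 (j - 1)) (matUnit n Y m j) = matUnit n Y (m + 1) (j - 1) := by
  rw [h.ad_unit_one hm hm', if_pos rfl, if_neg, smul_zero, sub_zero]
  intro e
  refine zmod_natCast_ne_zero (n := n) (k := m + 1) (by omega) hm' ?_
  push_cast
  linear_combination -e

lemma ad_unit_one_right {m : ℕ} (hm : 1 ≤ m) (hm' : m + 1 < 2 * n) (j : ZMod (2 * n)) :
    ad (matUnit n Y 1 (j + m)) (matUnit n Y m j) = -((-1 : ℂ) ^ m • matUnit n Y (m + 1) j) := by
  rw [h.ad_unit_one hm hm', if_neg, if_pos rfl, zero_sub]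
  intro e
  refine zmod_natCast_ne_zero (n := n) (k := m + 1) (by omega) hm' ?_
  push_cast
  linear_combination e

lemma ad_unit_one_of_ne {m : ℕ} (hm : 1 ≤ m) (hm' : m + 1 < 2 * n) {i j : ZMod (2 * n)}
    (h1 : i ≠ j - 1) (h2 : i ≠ j + m) : ad (matUnit n Y 1 i) (matUnit n Y m j) = 0 := by
  rw [h.ad_unit_one hm hm', if_neg h1, if_neg h2, smul_zero, sub_zero]

/-- For such i and j the elements E_(i,i+1) and E_(j,j+1) supercommute, so by Jacobi E_(i,i+1)
annihilates [E_(j,j+1), z] as soon as it annihilates z. -/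
lemma ad_ad_unit_eq_zero {i j : ZMod (2 * n)} {z : L} (h1 : i ≠ j - 1) (h2 : i ≠ j + 1)
    (hz : ad (matUnit n Y 1 i) z = 0) :
    ad (matUnit n Y 1 i) (ad (matUnit n Y 1 j) z) = 0 := by
  have hn := h.two_le
  rw [ad_ad (h.unit_mem le_rfl i) (h.unit_mem le_rfl j), hz,
    h.ad_unit_one_of_ne le_rfl (by omega) h1 (by simpa using h2)]
  simp [ad]

/-- Here `ad_unit_one` is out of range, so E_(j,j-1) is written as a bracket of two elements that
both supercommute with E_(i,i+1): E_(j,j+1) and E_(j+1,j-1) if i ≠ j, and E_(j-2,j-1) and E_(j,j-2)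
if i = j. -/
lemma ad_unit_one_last_of_ne_of_ne {i j : ZMod (2 * n)} (h1 : i ≠ j - 1) (h2 : i ≠ j + 1) :
    ad (matUnit n Y 1 i) (matUnit n Y (2 * n - 1) j) = 0 := by
  have hn := h.two_le
  have hp := zmod_natCast_sub_two hn
  have e0 : 2 * n - 2 + 1 = 2 * n - 1 := by omega
  by_cases h3 : i = j
  · subst h3
    have e := h.ad_unit_one_right (m := 2 * n - 2) (by omega) (by omega) i
    have hev : Even (2 * n - 2) := ⟨n - 1, by omega⟩
    rw [hev.neg_one_pow, one_smul, e0] at e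
    rw [← neg_neg (matUnit n Y (2 * n - 1) i), ← e, map_neg, neg_eq_zero]
    refine h.ad_ad_unit_eq_zero ?_ ?_
      (h.ad_unit_one_of_ne (by omega) (by omega) ?_ ?_)
    · intro e
      rw [hp] at e
      refine zmod_natCast_ne_zero (n := n) (k := 3) (by omega) (by omega) ?_
      push_cast
      linear_combination e
    · intro e
      rw [hp] at e
      refine zmod_natCast_ne_zero (n := n) (k := 1) (by omega) (by omega) ?_
      push_cast
      linear_combination e
    · exact h1
    · intro e
      rw [hp] at e
      refine zmod_natCast_ne_zero (n := n) (k := 2) (by omega) (by omega) ?_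
      push_cast
      linear_combination e
  · have e := h.ad_unit_one_left (m := 2 * n - 2) (by omega) (by omega) (j + 1)
    rw [add_sub_cancel_right, e0] at e
    rw [← e]
    refine h.ad_ad_unit_eq_zero h1 h2
      (h.ad_unit_one_of_ne (by omega) (by omega) ?_ ?_)
    · rwa [add_sub_cancel_right]
    · rw [hp]
      intro e
      exact h1 (by rw [e]; ring)

lemma ad_s_last_unit_eq_add (j : ZMod (2 * n)) : ad s (matUnit n Y (2 * n - 1) j) =
    ad (matUnit n Y 1 (j - 1)) (matUnit n Y (2 * n - 1) j) +
      ad (matUnit n Y 1 (j + 1)) (matUnit n Y (2 * n - 1) j) := by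
  have hn := h.two_le
  rw [← h.sum_ad_unit_one]
  refine Fintype.sum_eq_add _ _ ?_ fun i hi => h.ad_unit_one_last_of_ne_of_ne hi.1 hi.2
  intro e
  refine zmod_natCast_ne_zero (n := n) (k := 2) (by omega) (by omega) ?_
  push_cast
  linear_combination -e

lemma ad_d_ad_unit_pred (j : ZMod (2 * n)) :
    ad d (ad (matUnit n Y 1 (j - 1)) (matUnit n Y (2 * n - 1) j)) = 0 := by
  have hn := h.two_le
  rw [h.ad_d_ad_unit (by omega) (by omega)]
  have : (1 - root n) * chi n (j - 1) + (1 - root n ^ (2 * n - 1)) * chi n j = 0 := by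
    rw [← chi_sub_one j]
    linear_combination -chi n (j - 1) * root_mul_root_pow_sub_one hn
  rw [this, zero_smul]

/-- By `rel3`, in the form `ad_s_last`, [s, Y (2n-1) 1] is a multiple of d, so ad d kills it. Its
components [E_(j-1,j), E_(j,j-1)] have weight zero anyway, while the brackets considered here have
the distinct nonzero weights κ χ(j), so each of them vanishes. -/
lemma ad_unit_succ_last (j : ZMod (2 * n)) :
    ad (matUnit n Y 1 (j + 1)) (matUnit n Y (2 * n - 1) j) = 0 := by
  have hn := h.two_le
  set κ : ℂ := (1 - root n) * root n + (1 - root n ^ (2 * n - 1)) with hκ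
  have hκ0 : κ ≠ 0 := by
    -- As a^(2n-1) = 1/a, multiplication by a clears the denominator and lets κ factor.
    have e : root n * κ = -((1 - root n) * (1 - root n ^ 2)) := by
      linear_combination (-1 : ℂ) * root_mul_root_pow_sub_one hn
    have e2 := mul_ne_zero (one_sub_root_ne_zero hn)
      (one_sub_root_pow_ne_zero hn (m := 2) (by omega) (by omega))
    intro e3
    rw [e3, mul_zero, eq_comm, neg_eq_zero] at e
    exact e2 e
  have hw : ∀ j, ad d (ad (matUnit n Y 1 (j + 1)) (matUnit n Y (2 * n - 1) j)) =
      (κ * chi n j) • ad (matUnit n Y 1 (j + 1)) (matUnit n Y (2 * n - 1) j) := by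
    intro j
    rw [h.ad_d_ad_unit (by omega) (by omega), chi_add_one]
    congr 1
    ring
  have hsum : ∑ j, (chi n j * (κ * chi n j)) •
      ad (matUnit n Y 1 (j + 1)) (matUnit n Y (2 * n - 1) j) = ∑ _j : ZMod (2 * n), (0 : L) := by
    have e := h.sum_chi_pow_smul_unit (2 * n - 1) (k := 1) (by omega)
    have e2 : ad d (ad s (Y (2 * n - 1) 1)) = 0 := by
      rw [h.ad_s_last, map_smul, ad_self_even h.d_mem, smul_zero]
    rw [← e, map_sum, map_sum] at e2
    rw [Finset.sum_const_zero, ← e2]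
    refine Finset.sum_congr rfl fun j _ => ?_
    rw [map_smul, map_smul, h.ad_s_last_unit_eq_add, map_add, h.ad_d_ad_unit_pred, zero_add, hw,
      smul_smul, pow_one]
  have h0 := eq_of_sum_eq_of_eigen (ad d) (μ := fun j => κ * chi n j)
    (fun i i' e => ZMod.injective_stdAddChar (mul_left_cancel₀ hκ0 e))
    (fun j => by rw [map_smul, hw, smul_comm]) (by simp) hsum j
  exact (smul_eq_zero.1 h0).resolve_left
    (mul_ne_zero (chi_ne_zero j) (mul_ne_zero hκ0 (chi_ne_zero j)))

lemma ad_s_last_unit (j : ZMod (2 * n)) : ad s (matUnit n Y (2 * n - 1) j) =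
    ad (matUnit n Y 1 (j - 1)) (matUnit n Y (2 * n - 1) j) := by
  rw [h.ad_s_last_unit_eq_add, h.ad_unit_succ_last, add_zero]

theorem ad_d_ad_s_last {k : ℕ} (hk : k < 2 * n) : ad d (ad s (Y (2 * n - 1) k)) = 0 := by
  rw [← h.sum_chi_pow_smul_unit _ hk, map_sum, map_sum]
  refine Finset.sum_eq_zero fun j _ => ?_
  rw [map_smul, map_smul, h.ad_s_last_unit, h.ad_d_ad_unit_pred, smul_zero]

lemma unit_succ_zero {m : ℕ} (hm : 1 ≤ m) (hm' : m + 1 < 2 * n) :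
    matUnit n Y (m + 1) 0 =
      -((-1 : ℂ) ^ m • ad (matUnit n Y 1 (m : ZMod (2 * n))) (matUnit n Y m 0)) := by
  have e := h.ad_unit_one_right hm hm' 0
  rw [zero_add] at e
  rw [e, smul_neg, neg_neg, smul_smul, ← mul_pow]
  simp

/-- This is [E_(0,m), E_(-p,0)] = ∓E_(-p,m). Induction on m: E_(0,m+1) is up to sign [E_(m,m+1),
E_(0,m)], and E_(m,m+1) supercommutes with E_(-p,0). -/
lemma ad_unit_zero {m p : ℕ} (hm : 1 ≤ m) (hp : 1 ≤ p) (hmp : m + p < 2 * n) :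
    ad (matUnit n Y m 0) (matUnit n Y p (-p : ZMod (2 * n))) =
      -((-1 : ℂ) ^ (m * p) • matUnit n Y (m + p) (-p : ZMod (2 * n))) := by
  induction m, hm using Nat.le_induction with
  | base =>
    have e := h.ad_unit_one_right hp (by omega) (-p : ZMod (2 * n))
    rw [neg_add_cancel] at e
    rw [e, one_mul, add_comm 1 p]
  | succ m hm ih =>
    have z : ad (matUnit n Y 1 (m : ZMod (2 * n))) (matUnit n Y p (-p : ZMod (2 * n))) = 0 := by
      refine h.ad_unit_one_of_ne hp (by omega) ?_ ?_
      · intro e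
        refine zmod_natCast_ne_zero (n := n) (k := m + 1 + p) (by omega) (by omega) ?_
        push_cast
        linear_combination e
      · rw [neg_add_cancel]
        exact zmod_natCast_ne_zero (by omega) (by omega)
    have r := h.ad_unit_one_right (m := m + p) (by omega) (by omega) (-p : ZMod (2 * n))
    rw [show (-p : ZMod (2 * n)) + ((m + p : ℕ) : ZMod (2 * n)) = m by push_cast; ring] at r
    have j := ad_ad_left (h.unit_mem le_rfl (m : ZMod (2 * n))) (h.unit_mem hm 0)
      (matUnit n Y p (-p : ZMod (2 * n)))
    rw [z, map_zero, smul_zero, sub_zero, ih (by omega), map_neg, map_smul, r] at j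
    rw [h.unit_succ_zero hm (by omega), ad_neg_left, ad_smul_left, j, show m + 1 + p = m + p + 1 by ring]
    simp only [smul_neg, neg_neg, smul_smul]
    rw [← pow_add, ← pow_add, show m + (m * p + (m + p)) = 2 * m + (m + 1) * p by ring,
      pow_add _ (2 * m), pow_mul]
    simp

/-- The left side is [E_(0,m), E_(m,0)]. In the induction, Jacobi for E_(0,m+1) = ∓[E_(m,m+1),
E_(0,m)] against E_(m+1,0) gives the new summand, through [E_(0,m), E_(m+1,0)] = -E_(m+1,m), and the
preceding case, through [E_(m,m+1), E_(m+1,0)] = E_(m,0). -/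
lemma ad_unit_transpose {m : ℕ} (hm : 1 ≤ m) (hm' : m < 2 * n) :
    ad (matUnit n Y m 0) (matUnit n Y (2 * n - m) (m : ZMod (2 * n))) =
      ∑ t ∈ Finset.range m, (-1 : ℂ) ^ t •
        ad (matUnit n Y 1 (t : ZMod (2 * n))) (matUnit n Y (2 * n - 1) (t + 1 : ZMod (2 * n))) := by
  induction m, hm using Nat.le_induction with
  | base => simp
  | succ m hm ih =>
    obtain ⟨p, hp⟩ : ∃ p, 2 * n = m + 1 + p := ⟨2 * n - (m + 1), by omega⟩
    have e1 : 2 * n - (m + 1) = p := by omega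
    have e2 : 2 * n - m = p + 1 := by omega
    have e3 : 2 * n - 1 = m + p := by omega
    have e4 : (-p : ZMod (2 * n)) = m + 1 := by
      have := ZMod.natCast_self (2 * n)
      have h2 : ((2 * n : ℕ) : ZMod (2 * n)) = m + 1 + p := by
        rw [show ((2 * n : ℕ) : ZMod (2 * n)) = ((m + 1 + p : ℕ) : ZMod (2 * n)) from
          congrArg Nat.cast hp]
        push_cast
        ring
      linear_combination h2 - this
    have hB := h.ad_unit_zero hm (p := p) (by omega) (by omega)
    have hl := h.ad_unit_one_left (m := p) (by omega) (by omega) (m + 1)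
    rw [add_sub_cancel_right] at hl
    have j := ad_ad_left (h.unit_mem le_rfl (m : ZMod (2 * n))) (h.unit_mem hm 0)
      (matUnit n Y p (m + 1 : ZMod (2 * n)))
    have hev : Even (m * p) := by
      rcases Nat.even_or_odd m with hm2 | hm2
      · exact hm2.mul_right _
      · refine Even.mul_left ?_ _
        have : Even (m + 1 + p) := hp ▸ even_two_mul n
        exact (Nat.even_add.1 this).1 hm2.add_one
    rw [e4, hev.neg_one_pow, one_smul] at hB
    have ih' := ih (by omega)
    rw [e2] at ih'
    rw [hl, hB, map_neg, ih', one_mul] at j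
    rw [e1, h.unit_succ_zero hm hm', ad_neg_left, ad_smul_left, Nat.cast_add, Nat.cast_one, j, Finset.sum_range_succ, ← e3]
    rw [smul_sub, smul_smul, ← mul_pow]
    simp

/-- For m = 2n - 1 both entries of `ad_unit_transpose` are odd, so their bracket is symmetric.
Exchanged, it is the term t = 2n - 1 without its sign -1, and it cancels that term. -/
lemma sum_ad_unit_transpose : ∑ t ∈ Finset.range (2 * n), (-1 : ℂ) ^ t •
    ad (matUnit n Y 1 (t : ZMod (2 * n))) (matUnit n Y (2 * n - 1) (t + 1 : ZMod (2 * n))) = 0 := by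
  have hn := h.two_le
  have e := h.ad_unit_transpose (m := 2 * n - 1) (by omega) (by omega)
  have hodd : Odd (2 * n - 1) := ⟨n - 1, by omega⟩
  have hc : ((2 * n - 1 : ℕ) : ZMod (2 * n)) + 1 = 0 := by
    rw [← Nat.cast_add_one, Nat.sub_add_cancel (by omega), ZMod.natCast_self]
  rw [show 2 * n - (2 * n - 1) = 1 by omega,
    ad_skew (h.unit_mem (by omega) _) (h.unit_mem le_rfl _), mul_one, hodd.neg_one_pow] at e
  have hr : Finset.range (2 * n) = Finset.range (2 * n - 1 + 1) := by congr 1; omega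
  rw [hr, Finset.sum_range_succ, ← e, hodd.neg_one_pow, hc]
  simp

/-- Since χ(j)^n = (-1)^j, inverse Fourier transform writes the left side as minus the alternating
sum of `sum_ad_unit_transpose`, with j = t + 1. -/
theorem ad_s_last_half : ad s (Y (2 * n - 1) n) = 0 := by
  have hn := h.two_le
  rw [← h.sum_chi_pow_smul_unit (2 * n - 1) (k := n) (by omega), map_sum]
  rw [← neg_eq_zero, ← h.sum_ad_unit_transpose, ← Finset.sum_neg_distrib]
  symm
  refine Finset.sum_bij' (fun t _ => (t + 1 : ZMod (2 * n))) (fun j _ => (j - 1).val) ?_ ?_ ?_ ?_ ?_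
  · simp
  · exact fun j _ => Finset.mem_range.2 (ZMod.val_lt _)
  · intro t ht
    rw [add_sub_cancel_right, ZMod.val_natCast_of_lt (Finset.mem_range.1 ht)]
  · intro j _
    simp
  · intro t _
    rw [map_smul, h.ad_s_last_unit, add_sub_cancel_right, chi_add_one, chi_natCast, mul_pow,
      root_pow_half hn, ← pow_mul, mul_comm t n, pow_mul, root_pow_half hn]
    simp

end ClockShiftSystem
end Sylvester

/-! ### A spanning set deduced from the relations. -/

namespace Sylvester

open LieSuperalgebra SuperMatrix

section presentation

variable {n : ℕ} {L : Type*} [AddCommGroup L] [Module ℂ L] [LieSuperalgebra L] {d s : L}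

variable (n) in
/-- The element of the Lie superalgebra in the role of the matrix `D^k S^m`. -/
def abstractClockShift (d s : L) (m k : ℕ) : L :=
  (leading n m * (1 - root n ^ m) ^ (k + 2 * n - 1))⁻¹ •
    (ad d ^ (k + 2 * n - 1)) ((ad s ^ (m - 1)) (ad d s))

variable (n) in
/-- The relations hold for the even element `d` and the odd element `s`. -/
structure SatisfiesRelations (d s : L) : Prop where
  two_le : 2 ≤ n
  d_mem : d ∈ (part 0 : Submodule ℂ L)
  s_mem : s ∈ (part 1 : Submodule ℂ L)
  eq_of_relation : ∀ x y, Relation n d s x y → x = y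

namespace SatisfiesRelations

variable (h : SatisfiesRelations n d s)

include h

lemma ad_d_pow {m : ℕ} (hm : 1 ≤ m) (hm' : m < 2 * n) :
    (ad d ^ (2 * n)) ((ad s ^ (m - 1)) (ad d s)) =
      (1 - root n ^ m) ^ (2 * n) • (ad s ^ (m - 1)) (ad d s) := by
  rcases hm.eq_or_lt with rfl | hm
  · have e := h.eq_of_relation _ _ .rel1
    rw [Nat.sub_self, pow_zero, Module.End.one_apply, ← Module.End.mul_apply, ← pow_succ, pow_succ',
      Module.End.mul_apply, e, map_smul, pow_one]
  · exact h.eq_of_relation _ _ (.rel2 m hm (by omega))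

lemma normalization_ne_zero {m : ℕ} (hm : 1 ≤ m) (hm' : m < 2 * n) (k : ℕ) :
    leading n m * (1 - root n ^ m) ^ k ≠ 0 :=
  mul_ne_zero (leading_ne_zero h.two_le m)
    (pow_ne_zero _ (one_sub_root_pow_ne_zero h.two_le hm hm'))

/-- By `rel1` and `rel2`, (ad d)^(2n) is the scalar (1 - a^m)^(2n) here. This is why
`abstractClockShift` may use the exponent k + 2n - 1 in place of k - 1, and so make sense at k = 0.
-/
lemma abstract_add {m : ℕ} (hm : 1 ≤ m) (hm' : m < 2 * n) (k : ℕ) :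
    (leading n m * (1 - root n ^ m) ^ (k + 2 * n))⁻¹ •
      (ad d ^ (k + 2 * n)) ((ad s ^ (m - 1)) (ad d s)) =
    (leading n m * (1 - root n ^ m) ^ k)⁻¹ •
      (ad d ^ k) ((ad s ^ (m - 1)) (ad d s)) := by
  have h1 := one_sub_root_pow_ne_zero h.two_le hm hm'
  have h2 := leading_ne_zero h.two_le m
  rw [pow_add (ad d), Module.End.mul_apply, h.ad_d_pow hm hm', map_smul, smul_smul]
  congr 1
  rw [pow_add]
  have h3 := pow_ne_zero k h1
  have h4 := pow_ne_zero (2 * n) h1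
  field_simp

lemma T_eq {m k : ℕ} (hm : 1 ≤ m) (hm' : m < 2 * n) (hk : 1 ≤ k) : T n d s m k =
    (leading n m * (1 - root n ^ m) ^ (k - 1)) • abstractClockShift n d s m k := by
  rw [abstractClockShift, show k + 2 * n - 1 = k - 1 + 2 * n by omega, h.abstract_add hm hm',
    smul_smul, mul_inv_cancel₀ (h.normalization_ne_zero hm hm' _), one_smul, T, if_neg hm'.ne]

lemma abstract_periodic {m : ℕ} (hm : 1 ≤ m) (hm' : m < 2 * n) (k : ℕ) :
    abstractClockShift n d s m (k + 2 * n) = abstractClockShift n d s m k := by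
  have hn := h.two_le
  rw [abstractClockShift, abstractClockShift,
    show k + 2 * n + 2 * n - 1 = k + 2 * n - 1 + 2 * n by omega, h.abstract_add hm hm']

/-- The case s₁ = 1 of `path`; a single application of ad s is all that the spanning argument needs.
-/
lemma ad_s_T {m k : ℕ} (hm : 1 ≤ m) (hm' : m + 1 < 2 * n) (hk : 1 ≤ k) (hk' : k ≤ 2 * n) :
    ad s (T n d s m k) = coeff n k 1 (m - 1) • T n d s (m + 1) k := by
  have e := h.eq_of_relation _ _
    (.path (m + 1) k 1 (m - 1) (by omega) (by omega) hk hk' le_rfl (by omega))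
  rwa [Nat.sub_add_cancel hm, pow_one] at e

lemma ad_s_abstract {m k : ℕ} (hm : 1 ≤ m) (hm' : m + 1 < 2 * n) (hk : 1 ≤ k) (hk' : k ≤ 2 * n) :
    ad s (abstractClockShift n d s m k) =
      (root n ^ k - (-1) ^ m) • abstractClockShift n d s (m + 1) k := by
  have e := h.ad_s_T hm hm' hk hk'
  rw [h.T_eq hm (by omega) hk, h.T_eq (by omega) hm' hk, map_smul, smul_smul,
    coeff_one_mul h.two_le k m hm hm', mul_smul _ (root n ^ k - (-1) ^ m)] at e
  exact smul_right_injective L (h.normalization_ne_zero hm (by omega) (k - 1)) e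

lemma ad_d_abstract (m k : ℕ) (hm : 1 ≤ m) (hm' : m < 2 * n) :
    ad d (abstractClockShift n d s m k) =
      (1 - root n ^ m) • abstractClockShift n d s m (k + 1) := by
  have hn := h.two_le
  rw [abstractClockShift, abstractClockShift, map_smul, ← Module.End.mul_apply, ← pow_succ',
    smul_smul, show k + 1 + 2 * n - 1 = k + 2 * n - 1 + 1 by omega]
  congr 1
  have h1 := one_sub_root_pow_ne_zero h.two_le hm hm'
  have h2 := leading_ne_zero h.two_le m
  have h3 := pow_ne_zero (k + 2 * n - 1) h1
  rw [pow_succ]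
  field_simp

lemma ad_s_pow_mem {m : ℕ} (hm : 1 ≤ m) :
    (ad s ^ (m - 1)) (ad d s) ∈ (part (m : ZMod 2) : Submodule ℂ L) := by
  induction m, hm using Nat.le_induction with
  | base => simpa using ad_mem h.d_mem h.s_mem
  | succ m hm ih =>
    obtain ⟨m, rfl⟩ := Nat.exists_eq_add_of_le' hm
    rw [Nat.add_sub_cancel] at ih ⊢
    rw [pow_succ', Module.End.mul_apply, Nat.cast_succ (m + 1), add_comm]
    exact ad_mem h.s_mem ih

lemma ad_d_pow_mem {i : ZMod 2} {x : L} (hx : x ∈ part i) (k : ℕ) :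
    (ad d ^ k) x ∈ (part i : Submodule ℂ L) := by
  induction k with
  | zero => simpa using hx
  | succ k ih =>
    rw [pow_succ', Module.End.mul_apply]
    simpa using ad_mem h.d_mem ih

theorem clockShiftSystem : ClockShiftSystem n d s (abstractClockShift n d s) where
  two_le := h.two_le
  d_mem := h.d_mem
  s_mem := h.s_mem
  mem m k hm := Submodule.smul_mem _ _ (h.ad_d_pow_mem (h.ad_s_pow_mem hm) _)
  ad_d := h.ad_d_abstract
  periodic m k hm hm' := h.abstract_periodic hm hm' k
  ad_s m k hm hm' hk := by
    -- The relations `path` start at k = 1; periodicity supplies k = 0 from k = 2n.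
    rcases Nat.eq_zero_or_pos k with rfl | hk0
    · have e := h.ad_s_abstract hm hm' (k := 2 * n) (by omega) le_rfl
      have p1 := h.abstract_periodic hm (by omega) 0
      have p2 := h.abstract_periodic (m := m + 1) (by omega) hm' 0
      rw [zero_add] at p1 p2
      rwa [p1, p2, root_pow_two_mul h.two_le, ← pow_zero (root n)] at e
    · exact h.ad_s_abstract hm hm' hk0 hk.le
  one_zero := by
    have hn := h.two_le
    have e := h.eq_of_relation _ _ .rel1
    rw [abstractClockShift, Nat.sub_self, pow_zero, Module.End.one_apply, ← Module.End.mul_apply,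
      ← pow_succ, zero_add, Nat.sub_add_cancel (by omega), e, leading_one, pow_one, ← pow_succ',
      Nat.sub_add_cancel (by omega), smul_smul,
      inv_mul_cancel₀ (pow_ne_zero _ (one_sub_root_ne_zero hn)), one_smul]
  ad_s_last := by
    have hn := h.two_le
    have e := h.eq_of_relation _ _ .rel3
    rw [h.T_eq (by omega) (by omega) le_rfl, map_smul, Nat.sub_self, pow_zero, mul_one,
      ← leading_last_mul hn, mul_smul] at e
    exact smul_right_injective L (leading_ne_zero hn _) e

lemma T_two_mul (k : ℕ) : T n d s (2 * n) k = ad s (T n d s (2 * n - 1) k) := by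
  have hn := h.two_le
  rw [T, if_pos rfl, T, if_neg (by omega), show 2 * n - 1 - 1 = 2 * n - 2 by omega]

/-- The elements missing from the family cost nothing: T_1^(2n) is a multiple of s, T_(2n)^1 a
multiple of d, and T_(2n)^n is zero. -/
lemma T_mem {q : ℕ × ℕ} (h1 : 1 ≤ q.1) (h2 : q.1 ≤ 2 * n) (h3 : 1 ≤ q.2) (h4 : q.2 ≤ 2 * n) :
    T n d s q.1 q.2 ∈ Submodule.span ℂ (Set.range (generatorFamily n d s)) := by
  obtain ⟨m, k⟩ := q
  simp only at h1 h2 h3 h4 ⊢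
  have hn := h.two_le
  have : NeZero (2 * n) := ⟨by omega⟩
  have hY := h.clockShiftSystem
  by_cases c1 : m = 1 ∧ k = 2 * n
  · obtain ⟨rfl, rfl⟩ := c1
    have p := h.abstract_periodic (m := 1) le_rfl (by omega) 0
    rw [zero_add] at p
    rw [h.T_eq le_rfl (by omega) h3, p, hY.one_zero]
    exact Submodule.smul_mem _ _ (Submodule.subset_span ⟨.inl 1, rfl⟩)
  by_cases c2 : m = 2 * n ∧ k = 1
  · obtain ⟨rfl, rfl⟩ := c2
    rw [h.T_two_mul, h.T_eq (by omega) (by omega) le_rfl, map_smul, hY.ad_s_last]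
    exact Submodule.smul_mem _ _ (Submodule.smul_mem _ _ (Submodule.subset_span ⟨.inl 0, rfl⟩))
  by_cases c3 : m = 2 * n ∧ k = n
  · obtain ⟨rfl, hk⟩ := c3
    rw [h.T_two_mul, h.T_eq (by omega) (by omega) h3, map_smul, hk, hY.ad_s_last_half, smul_zero]
    exact zero_mem _
  refine Submodule.subset_span ⟨.inr ⟨(m, k), ⟨h1, h2, h3, h4, ?_, ?_⟩, ?_⟩, rfl⟩
  · exact fun a b => c1 ⟨a, b⟩
  · exact fun a b => c2 ⟨a, b⟩
  · simpa using c3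

/-- The bound 2n + 1 leaves room for the increase of k by one under ad d. -/
lemma abstract_mem {m k : ℕ} (hm : 1 ≤ m) (hm' : m < 2 * n) (hk : 1 ≤ k) (hk' : k ≤ 2 * n + 1) :
    abstractClockShift n d s m k ∈ Submodule.span ℂ (Set.range (generatorFamily n d s)) := by
  have key : ∀ k, 1 ≤ k → k ≤ 2 * n → abstractClockShift n d s m k ∈
      Submodule.span ℂ (Set.range (generatorFamily n d s)) := by
    intro k hk hk'
    have e := h.T_mem (q := (m, k)) hm hm'.le hk hk'
    rw [h.T_eq hm hm' hk] at e
    exact (Submodule.smul_mem_iff _ (h.normalization_ne_zero hm hm' _)).1 e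
  rcases hk'.eq_or_lt with rfl | hk'
  · rw [add_comm, h.abstract_periodic hm hm']
    exact key 1 le_rfl (by omega)
  · exact key k hk (by omega)

theorem span_stable_d {x : L} (hx : x ∈ Submodule.span ℂ (Set.range (generatorFamily n d s))) :
    ad d x ∈ Submodule.span ℂ (Set.range (generatorFamily n d s)) := by
  have hn := h.two_le
  have : NeZero (2 * n) := ⟨by omega⟩
  have hY := h.clockShiftSystem
  induction hx using Submodule.span_induction with
  | zero => rw [map_zero]; exact zero_mem _
  | add x y _ _ hx hy => rw [map_add]; exact add_mem hx hy
  | smul c x _ hx => rw [map_smul]; exact Submodule.smul_mem _ _ hx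
  | mem x hx =>
    obtain ⟨i | ⟨⟨m, k⟩, ⟨h1, h2, h3, h4, h5, h6⟩, h7⟩, rfl⟩ := hx
    · fin_cases i
      · change ad d d ∈ _
        rw [ad_self_even h.d_mem]
        exact zero_mem _
      · change ad d s ∈ _
        have e := h.T_mem (q := (1, 1)) le_rfl (by simp only; omega) le_rfl (by simp only; omega)
        rw [T, if_neg (by simp only; omega)] at e
        simpa using e
    · change ad d (T n d s m k) ∈ _
      simp only at h1 h2 h3 h4
      rcases h2.lt_or_eq with h2 | rfl
      · rw [h.T_eq h1 h2 h3, map_smul, h.ad_d_abstract m k h1 h2]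
        exact Submodule.smul_mem _ _ (Submodule.smul_mem _ _
          (h.abstract_mem h1 h2 (by omega) (by omega)))
      -- No relation states that d commutes with T_(2n)^k; it comes from the matrix units.
      · have e : ad d (ad s (abstractClockShift n d s (2 * n - 1) k)) = 0 := by
          rcases h4.lt_or_eq with h4 | rfl
          · exact hY.ad_d_ad_s_last h4
          · have p := h.abstract_periodic (m := 2 * n - 1) (by omega) (by omega) 0
            rw [zero_add] at p
            rw [p]
            exact hY.ad_d_ad_s_last (by omega)
        rw [h.T_two_mul, h.T_eq (by omega) (by omega) h3, map_smul, map_smul, e, smul_zero]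
        exact zero_mem _

theorem span_stable_s {x : L} (hx : x ∈ Submodule.span ℂ (Set.range (generatorFamily n d s))) :
    ad s x ∈ Submodule.span ℂ (Set.range (generatorFamily n d s)) := by
  have hn := h.two_le
  induction hx using Submodule.span_induction with
  | zero => rw [map_zero]; exact zero_mem _
  | add x y _ _ hx hy => rw [map_add]; exact add_mem hx hy
  | smul c x _ hx => rw [map_smul]; exact Submodule.smul_mem _ _ hx
  | mem x hx =>
    obtain ⟨i | ⟨⟨m, k⟩, ⟨h1, h2, h3, h4, h5, h6⟩, h7⟩, rfl⟩ := hx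
    · fin_cases i
      · change ad s d ∈ _
        rw [ad_skew (m := 1) (p := 0) (by simpa using h.s_mem) (by simpa using h.d_mem)]
        exact neg_mem (Submodule.smul_mem _ _
          (h.span_stable_d (Submodule.subset_span ⟨.inl 1, rfl⟩)))
      · change ad s s ∈ _
        rw [h.eq_of_relation _ _ .rel5]
        exact Submodule.smul_mem _ _ (h.T_mem (q := (2, 2 * n)) (by simp only; omega)
          (by simp only; omega) (by simp only; omega) le_rfl)
    · change ad s (T n d s m k) ∈ _
      simp only at h1 h2 h3 h4 h5 h6
      rcases h2.lt_or_eq with h2 | rfl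
      · by_cases h8 : m + 1 < 2 * n
        · rw [h.ad_s_T h1 h8 h3 h4]
          exact Submodule.smul_mem _ _ (h.T_mem (q := (m + 1, k)) (by simp only; omega) h8.le h3 h4)
        · obtain rfl : m = 2 * n - 1 := by omega
          rw [← h.T_two_mul]
          exact h.T_mem (q := (2 * n, k)) (by simp only; omega) le_rfl h3 h4
      -- `rel4` starts at k = 2, and `indexSet` omits k = 1 for m = 2n.
      · rw [h.eq_of_relation _ _ (.rel4 k (by have := h6 rfl; omega) h4)]
        exact Submodule.smul_mem _ _ (h.T_mem (q := (1, k)) le_rfl (by simp only; omega) h3 h4)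

end SatisfiesRelations

end presentation

/-! ### The kernel and the range of the map from the free Lie superalgebra. -/

section free

lemma freeD_mem : freeD ∈ (part 0 : Submodule ℂ Free) :=
  Submodule.subset_span ⟨.of .D, rfl, rfl⟩

lemma freeS_mem : freeS ∈ (part 1 : Submodule ℂ Free) :=
  Submodule.subset_span ⟨.of .S, rfl, rfl⟩

/-- By Jacobi, stability under the bracket with letters extends to all words; a word u * v then lies
in V because v does. -/
theorem eq_top_of_ad_stable {V : Submodule ℂ Free} (hD : freeD ∈ V) (hS : freeS ∈ V)
    (sD : ∀ x ∈ V, ad freeD x ∈ V) (sS : ∀ x ∈ V, ad freeS x ∈ V) : V = ⊤ := by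
  have hmul : ∀ u v, FreeLieSuper.mk letterParity (u * v) =
      ad (FreeLieSuper.mk letterParity u) (FreeLieSuper.mk letterParity v) :=
    fun u v => (FreeLieSuper.bracketF_mk letterParity u v).symm
  have hpart : ∀ u, FreeLieSuper.mk letterParity u ∈
      (part (FreeLieSuper.wordParity letterParity u) : Submodule ℂ Free) :=
    fun u => Submodule.subset_span ⟨u, rfl, rfl⟩
  have stable : ∀ u, ∀ x ∈ V, ad (FreeLieSuper.mk letterParity u) x ∈ V := by
    intro u
    induction u with
    | ih1 l =>
      cases l
      · exact sD
      · exact sS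
    | ih2 u v hu hv =>
      rw [hmul]
      exact ad_ad_stable (hpart u) (hpart v) hu hv
  have words : ∀ u, FreeLieSuper.mk letterParity u ∈ V := by
    intro u
    induction u with
    | ih1 l =>
      cases l
      · exact hD
      · exact hS
    | ih2 u v _ hv =>
      rw [hmul]
      exact stable u _ hv
  rw [eq_top_iff]
  rintro x -
  obtain ⟨x, rfl⟩ := (FreeLieSuper.identityIdeal letterParity).mkQ_surjective x
  induction x using FreeLieSuper.pre_induction with
  | h0 => rw [map_zero]; exact zero_mem _
  | hadd x y hx hy => rw [map_add]; exact add_mem hx hy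
  | hsmul c x hx => rw [map_smul]; exact Submodule.smul_mem _ c hx
  | hw u => exact words u

variable {n : ℕ}

lemma toMatrix_ad (x y : Free) : toMatrix n (ad x y) = ad (toMatrix n x) (toMatrix n y) :=
  FreeLieSuper.lift_bracket _ _ _ x y

lemma toMatrix_freeD : toMatrix n freeD = clock n := FreeLieSuper.lift_gen _ _ _ _

lemma toMatrix_freeS : toMatrix n freeS = shift n := FreeLieSuper.lift_gen _ _ _ _

lemma toMatrix_mem {i : ZMod 2} {x : Free} (hx : x ∈ (part i : Submodule ℂ Free)) :
    toMatrix n x ∈ (part i : Submodule ℂ (SMat n)) := by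
  induction hx using Submodule.span_induction with
  | mem x hx =>
    obtain ⟨u, rfl, rfl⟩ := hx
    have e : toMatrix n (FreeLieSuper.mk letterParity u) =
        FreeLieSuper.evalWord (letterMatrix n) u := FreeLieSuper.evalPre_word _ u
    rw [e]
    exact FreeLieSuper.evalWord_mem letterParity _ (letterMatrix_mem n) u
  | zero => rw [map_zero]; exact zero_mem _
  | add x y _ _ hx hy => rw [map_add]; exact add_mem hx hy
  | smul c x _ hx => rw [map_smul]; exact Submodule.smul_mem _ c hx

lemma map_generatorFamily {L L' : Type*} [AddCommGroup L] [Module ℂ L] [LieSuperalgebra L]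
    [AddCommGroup L'] [Module ℂ L'] [LieSuperalgebra L'] {f : L →ₗ[ℂ] L'}
    (hf : ∀ x y, f (ad x y) = ad (f x) (f y)) (d s : L) (i) :
    f (generatorFamily n d s i) = generatorFamily n (f d) (f s) i := by
  rcases i with i | q
  · fin_cases i <;> rfl
  · exact map_T hf n d s _ _

theorem range_toMatrix (hn : 2 ≤ n) : LinearMap.range (toMatrix n) = sl n := by
  have hmem : ∀ i, generatorFamily n (clock n) (shift n) i ∈ sl n := by
    intro i
    rw [← span_generatorFamily hn]
    exact Submodule.subset_span ⟨i, rfl⟩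
  apply le_antisymm
  · rw [LinearMap.range_le_iff_comap]
    refine eq_top_of_ad_stable ?_ ?_ (fun x _ => ?_) (fun x _ => ?_)
    · rw [Submodule.mem_comap, toMatrix_freeD]
      exact hmem (.inl 0)
    · rw [Submodule.mem_comap, toMatrix_freeS]
      exact hmem (.inl 1)
    · rw [Submodule.mem_comap, toMatrix_ad]
      exact supertrace_ad _ _
    · rw [Submodule.mem_comap, toMatrix_ad]
      exact supertrace_ad _ _
  · rw [← span_generatorFamily hn, Submodule.span_le]
    rintro _ ⟨i, rfl⟩
    refine ⟨generatorFamily n freeD freeS i, ?_⟩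
    rw [map_generatorFamily toMatrix_ad, toMatrix_freeD, toMatrix_freeS]

lemma isIdeal_ker_toMatrix : IsIdeal (LinearMap.ker (toMatrix n)) := by
  refine ⟨isGraded_iff.2 fun x₀ h₀ x₁ h₁ hx => ?_, fun x y hy => ?_⟩
  · rw [LinearMap.mem_ker, map_add] at hx
    exact eq_zero_of_add_eq_zero (toMatrix_mem h₀) (toMatrix_mem h₁) hx
  · rw [LinearMap.mem_ker] at hy ⊢
    rw [toMatrix_ad, hy, map_zero]

/-- Modulo the relations, a kernel element x equals a combination y of the generating family. The
matrix of y is zero, so linear independence makes all coefficients zero, and x lies in the ideal. -/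
theorem ker_toMatrix (hn : 2 ≤ n) : LinearMap.ker (toMatrix n) =
    idealGenerated {z | ∃ x y, Relation n freeD freeS x y ∧ z = x - y} := by
  set R : Set Free := {z | ∃ x y, Relation n freeD freeS x y ∧ z = x - y} with hR
  have hle : idealGenerated R ≤ LinearMap.ker (toMatrix n) := by
    refine sInf_le ⟨?_, isIdeal_ker_toMatrix⟩
    rintro _ ⟨x, y, hxy, rfl⟩
    have e := hxy.map (f := toMatrix n) toMatrix_ad
    rw [toMatrix_freeD, toMatrix_freeS] at e
    rw [SetLike.mem_coe, LinearMap.mem_ker, map_sub, relation_clock_shift hn e, sub_self]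
  refine le_antisymm (fun x hx => ?_) hle
  let _ := quotient (idealGenerated R) (isIdeal_idealGenerated R)
  have hf : ∀ x y : Free, (idealGenerated R).mkQ (ad x y) =
      ad ((idealGenerated R).mkQ x) ((idealGenerated R).mkQ y) := fun x y => rfl
  have hrel : SatisfiesRelations n ((idealGenerated R).mkQ freeD)
      ((idealGenerated R).mkQ freeS) := by
    refine ⟨hn, ⟨_, freeD_mem, rfl⟩, ⟨_, freeS_mem, rfl⟩, fun x' y' h => ?_⟩
    obtain ⟨x, y, hxy, rfl, rfl⟩ := h.exists_lift hf
    exact (Submodule.Quotient.eq _).2 (subset_idealGenerated R ⟨x, y, hxy, rfl⟩)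
  have htop : Submodule.comap (idealGenerated R).mkQ (Submodule.span ℂ (Set.range
      (generatorFamily n ((idealGenerated R).mkQ freeD) ((idealGenerated R).mkQ freeS)))) = ⊤ :=
    eq_top_of_ad_stable (Submodule.subset_span ⟨.inl 0, rfl⟩) (Submodule.subset_span ⟨.inl 1, rfl⟩)
      (fun x hx => hrel.span_stable_d hx) (fun x hx => hrel.span_stable_s hx)
  have hx' : x ∈ Submodule.comap (idealGenerated R).mkQ (Submodule.span ℂ (Set.range
      (generatorFamily n ((idealGenerated R).mkQ freeD) ((idealGenerated R).mkQ freeS)))) := by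
    rw [htop]; trivial
  rw [Submodule.mem_comap, Finsupp.mem_span_range_iff_exists_finsupp] at hx'
  obtain ⟨c, hc⟩ := hx'
  set y : Free := c.sum fun i a => a • generatorFamily n freeD freeS i with hy
  have hxy : (idealGenerated R).mkQ y = (idealGenerated R).mkQ x := by
    rw [← hc, hy, map_finsuppSum]
    refine Finsupp.sum_congr fun i _ => ?_
    rw [map_smul, map_generatorFamily hf]
  have hI : y - x ∈ idealGenerated R := (Submodule.Quotient.eq _).1 hxy
  have hy0 : toMatrix n y = 0 := by
    have := hle hI
    rw [LinearMap.mem_ker, map_sub, LinearMap.mem_ker.1 hx, sub_zero] at this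
    exact this
  have hc0 : c = 0 := by
    refine (linearIndependent_iff.1 (linearIndependent_generatorFamily hn)) c ?_
    rw [Finsupp.linearCombination_apply, ← hy0, hy, map_finsuppSum]
    refine Finsupp.sum_congr fun i _ => ?_
    rw [map_smul, map_generatorFamily toMatrix_ad, toMatrix_freeD, toMatrix_freeS]
  have hy00 : y = 0 := by rw [hy, hc0, Finsupp.sum_zero_index]
  rw [hy00, zero_sub, neg_mem_iff] at hI
  exact hI

end free

end Sylvester

end

theorem theorem2 (n : ℕ) (hn : 2 ≤ n) :
    -- `D` is even, `S` is odd, and together they generate `sl(n|n)`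
    SuperMatrix.clock n ∈ (LieSuperalgebra.part 0 : Submodule ℂ (SuperMatrix.SMat n)) ∧
    SuperMatrix.shift n ∈ (LieSuperalgebra.part 1 : Submodule ℂ (SuperMatrix.SMat n)) ∧
    LieSuperalgebra.generated {SuperMatrix.clock n, SuperMatrix.shift n} = SuperMatrix.sl n ∧
    -- `sl(n|n)` is spanned by `D`, `S` and the `T_m^k`
    SuperMatrix.sl n = Submodule.span ℂ
      ({SuperMatrix.clock n, SuperMatrix.shift n} ∪
        (fun q : ℕ × ℕ => Sylvester.T n (SuperMatrix.clock n) (SuperMatrix.shift n) q.1 q.2) ''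
          Sylvester.indexSet n) ∧
    -- of these, `T_(2n)^n` is zero, and the others form a basis
    Sylvester.T n (SuperMatrix.clock n) (SuperMatrix.shift n) (2 * n) n = 0 ∧
    LinearIndependent ℂ
      (Sum.elim ![SuperMatrix.clock n, SuperMatrix.shift n]
        (fun q : ↥(Sylvester.indexSet n \ {(2 * n, n)}) =>
          Sylvester.T n (SuperMatrix.clock n) (SuperMatrix.shift n) q.1.1 q.1.2)) ∧
    -- the relations hold, and they are defining: `sl(n|n)` is the image of the free Lie
    -- superalgebra, and the kernel is the ideal generated by the relations
    (∀ x y, Sylvester.Relation n (SuperMatrix.clock n) (SuperMatrix.shift n) x y → x = y) ∧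
    LinearMap.range (Sylvester.toMatrix n) = SuperMatrix.sl n ∧
    LinearMap.ker (Sylvester.toMatrix n) =
      LieSuperalgebra.idealGenerated
        {z | ∃ x y, Sylvester.Relation n Sylvester.freeD Sylvester.freeS x y ∧ z = x - y} := by
  exact ⟨SuperMatrix.clock_mem n, SuperMatrix.shift_mem n, Sylvester.generated_eq_sl hn,
    Sylvester.sl_eq_span hn, Sylvester.T_last_half_eq_zero hn,
    Sylvester.linearIndependent_generatorFamily hn,
    fun _ _ => Sylvester.relation_clock_shift hn, Sylvester.range_toMatrix hn,
    Sylvester.ker_toMatrix hn⟩
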